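/- Let $m,n\ge 1$ be integers. Let $\mathbb S^k\subset\mathbb R^{k+1}$ be the Euclidean unit sphere and $\mathbb B^{k+1}$ the closed unit ball. Let $\mathbb H_n=\mathbb C^n\times\mathbb R=\mathbb R^{2n+1}$, with coordinates $(z,t)$, $z_j=x_j+iy_j$, be the Heisenberg group equipped with its Carnot–Carathéodory metric $d_{cc}$: $d_{cc}(p,q)$ is the infimum of the lengths of the absolutely continuous curves from $p$ to $q$ that are almost everywhere tangent to the span of the vector fields $$X_j=\frac{\partial}{\partial x_j}+2y_j\frac{\partial}{\partial t},\qquad Y_j=\frac{\partial}{\partial y_j}-2x_j\frac{\partial}{\partial t},\qquad j=1,\dots,n,$$ where length is measured in the metric that makes $X_1,Y_1,\dots,X_n,Y_n$ orthonormal at every point. The homotopy group $\pi_m(\mathbb S^n)$ is called rank-essential if there is $f\in C^\infty(\mathbb S^m,\mathbb S^n)$ such that for every Lipschitz map $F:\mathbb B^{m+1}\to\mathbb R^{n+1}$ with $F|_{\partial\mathbb B^{m+1}}=f$ we have $\operatorname{rank} dF=n+1$ on a set of positive measure. For a metric space $X$ with base point $x_0$, the Lipschitz homotopy group $\pi_m^{\rm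 Lip}(X,x_0)$ is the group of Lipschitz maps $([0,1]^m,\partial[0,1]^m)\to(X,x_0)$ modulo Lipschitz homotopies $[0,1]^m\times[0,1]\to X$ relative to $\partial[0,1]^m$, with the product induced by concatenation in the first coordinate. **Theorem.** If $\pi_m(\mathbb S^n)$ is rank-essential, then $\pi_m^{\rm Lip}(\mathbb H_n,p)\neq\{0\}$ for every base point $p\in\mathbb H_n$. -/

import Mathlib

open scoped ContDiff Manifold

noncomputable section

/-! ### Lipschitz homotopy groups -/

namespace LipHomotopy

open Set

/-- `f` is Lipschitz (with some constant). -/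
def IsLipschitz {Y Z : Type*} [PseudoEMetricSpace Y] [PseudoEMetricSpace Z] (f : Y → Z) : Prop :=
  ∃ K, LipschitzWith K f

section Basic

variable {W Y Z : Type*} [PseudoEMetricSpace W] [PseudoEMetricSpace Y] [PseudoEMetricSpace Z]

theorem IsLipschitz.comp {f : Y → Z} {g : W → Y} (hf : IsLipschitz f) (hg : IsLipschitz g) :
    IsLipschitz fun x => f (g x) := by
  obtain ⟨K, hK⟩ := hf
  obtain ⟨L, hL⟩ := hg
  exact ⟨_, hK.comp hL⟩

theorem IsLipschitz.prodMk {f : W → Y} {g : W → Z} (hf : IsLipschitz f) (hg : IsLipschitz g) :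
    IsLipschitz fun x => (f x, g x) := by
  obtain ⟨K, hK⟩ := hf
  obtain ⟨L, hL⟩ := hg
  exact ⟨_, hK.prodMk hL⟩

theorem isLipschitz_id : IsLipschitz fun x : Y => x := ⟨1, LipschitzWith.id⟩

theorem isLipschitz_const (z : Z) : IsLipschitz fun _ : Y => z := ⟨0, LipschitzWith.const z⟩

theorem isLipschitz_fst : IsLipschitz fun p : Y × Z => p.1 := ⟨1, LipschitzWith.prod_fst⟩

theorem isLipschitz_snd : IsLipschitz fun p : Y × Z => p.2 := ⟨1, LipschitzWith.prod_snd⟩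

/-- Two Lipschitz maps that agree on the slice `c = 1/2` glue to a Lipschitz map, provided that the
space retracts onto the slice, moving points no further than the change of `c`. -/
theorem IsLipschitz.glue {f g : Y → Z} (hf : IsLipschitz f) (hg : IsLipschitz g)
    (c : Y → ℝ) (hc : LipschitzWith 1 c) (r : Y → Y)
    (hr : ∀ y, edist y (r y) ≤ edist (c y) (1 / 2)) (hfg : ∀ y, f (r y) = g (r y)) :
    IsLipschitz fun y => if c y ≤ 1 / 2 then f y else g y := by
  obtain ⟨K, hK⟩ := hf
  obtain ⟨L, hL⟩ := hg
  have key : ∀ x y, c x ≤ 1 / 2 → ¬ c y ≤ 1 / 2 →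
      edist (f x) (g y) ≤ (K + 2 * L : NNReal) * edist x y := by
    intro x y hx hy
    have h1 : edist x (r x) ≤ edist x y := by
      refine (hr x).trans (le_trans ?_ (by simpa using hc x y))
      rw [edist_dist, edist_dist]
      apply ENNReal.ofReal_le_ofReal
      rw [Real.dist_eq, Real.dist_eq, abs_of_nonpos (by linarith), abs_of_nonpos (by linarith)]
      linarith
    have h2 : edist (r x) y ≤ 2 * edist x y := by
      calc edist (r x) y ≤ edist (r x) x + edist x y := edist_triangle _ _ _
        _ ≤ edist x y + edist x y := by rw [edist_comm (r x)]; gcongr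
        _ = 2 * edist x y := by ring
    calc edist (f x) (g y) ≤ edist (f x) (f (r x)) + edist (g (r x)) (g y) := by
          rw [← hfg]; exact edist_triangle _ _ _
      _ ≤ K * edist x (r x) + L * edist (r x) y := add_le_add (hK _ _) (hL _ _)
      _ ≤ K * edist x y + L * (2 * edist x y) := by gcongr
      _ = (K + 2 * L : NNReal) * edist x y := by push_cast; ring
  refine ⟨K + 2 * L, fun x y => ?_⟩
  dsimp only
  split_ifs with hx hy hy
  · refine (hK x y).trans ?_
    gcongr
    exact le_self_add
  · exact key x y hx hy
  · rw [edist_comm, edist_comm x]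
    exact key y x hy hx
  · refine (hL x y).trans ?_
    gcongr
    calc L ≤ 2 * L := by rw [two_mul]; exact le_self_add
      _ ≤ K + 2 * L := le_add_self

end Basic

/-- Projection of `ℝ` onto the unit interval. -/
def clamp (s : ℝ) : unitInterval := projIcc 0 1 zero_le_one s

theorem clamp_of_le {s : ℝ} (h : s ≤ 0) : clamp s = 0 := projIcc_of_le_left _ h

theorem clamp_of_ge {s : ℝ} (h : 1 ≤ s) : clamp s = 1 := projIcc_of_right_le _ h

theorem coe_clamp (s : ℝ) : (clamp s : ℝ) = max 0 (min 1 s) := coe_projIcc _ _ _ _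

theorem clamp_coe (s : unitInterval) : clamp s = s := projIcc_val _ _

theorem isLipschitz_clamp : IsLipschitz clamp := ⟨1, LipschitzWith.projIcc zero_le_one⟩

theorem isLipschitz_coe : IsLipschitz fun s : unitInterval => (s : ℝ) := ⟨1, LipschitzWith.subtype_val _⟩

section Real

variable {W : Type*} [PseudoEMetricSpace W]

theorem IsLipschitz.add {f g : W → ℝ} (hf : IsLipschitz f) (hg : IsLipschitz g) :
    IsLipschitz fun x => f x + g x := by
  obtain ⟨K, hK⟩ := hf
  obtain ⟨L, hL⟩ := hg
  exact ⟨_, hK.add hL⟩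

theorem IsLipschitz.const_mul {f : W → ℝ} (c : ℝ) (hf : IsLipschitz f) :
    IsLipschitz fun x => c * f x :=
  IsLipschitz.comp (f := fun y : ℝ => c * y) ⟨_, lipschitzWith_smul c⟩ hf

theorem isLipschitz_of_affine (a b : ℝ) :
    IsLipschitz fun s : unitInterval => clamp (a * s + b) :=
  isLipschitz_clamp.comp ((isLipschitz_coe.const_mul a).add (isLipschitz_const b))

/-- Products of Lipschitz functions with values in the unit interval are Lipschitz. -/
theorem isLipschitz_mul : IsLipschitz fun p : unitInterval × unitInterval => p.1 * p.2 := by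
  refine ⟨2, LipschitzWith.of_dist_le_mul fun p q => ?_⟩
  rw [Subtype.dist_eq, Real.dist_eq]
  have h1 : |(p.1 : ℝ) - q.1| ≤ dist p q := by
    rw [← Real.dist_eq, ← Subtype.dist_eq]; exact le_max_left _ _
  have h2 : |(p.2 : ℝ) - q.2| ≤ dist p q := by
    rw [← Real.dist_eq, ← Subtype.dist_eq]; exact le_max_right _ _
  have e : ((p.1 * p.2 : unitInterval) : ℝ) - (q.1 * q.2 : unitInterval)
      = p.1 * ((p.2 : ℝ) - q.2) + (p.1 - q.1) * q.2 := by push_cast; ring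
  rw [e]
  refine (abs_add_le _ _).trans ?_
  rw [abs_mul, abs_mul, abs_of_nonneg p.1.2.1, abs_of_nonneg q.2.2.1]
  have a1 := p.1.2.2
  have a2 := q.2.2.2
  have b1 := p.1.2.1
  have b2 := q.2.2.1
  have c1 := abs_nonneg ((p.1 : ℝ) - q.1)
  have c2 := abs_nonneg ((p.2 : ℝ) - q.2)
  push_cast
  nlinarith

end Real

/-- The cube `[0,1]^m`. -/
abbrev CubeSpace (m : ℕ) : Type := Fin m → unitInterval

theorem isLipschitz_eval {m : ℕ} (i : Fin m) : IsLipschitz fun x : CubeSpace m => x i :=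
  ⟨1, LipschitzWith.eval i⟩

theorem isLipschitz_update {m : ℕ} (i : Fin m) :
    IsLipschitz fun p : CubeSpace m × unitInterval => Function.update p.1 i p.2 := by
  refine ⟨1, fun p q => ?_⟩
  rw [ENNReal.coe_one, one_mul, edist_pi_le_iff]
  intro j
  by_cases h : j = i
  · subst h
    simp only [Function.update_self]
    exact le_max_right (edist p.1 q.1) (edist p.2 q.2)
  · simp only [Function.update_of_ne h]
    exact (edist_le_pi_edist p.1 q.1 j).trans (le_max_left _ (edist p.2 q.2))

section Defs

variable (m : ℕ) {X : Type*} [PseudoEMetricSpace X]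

/-- Lipschitz maps `([0,1]^m, ∂[0,1]^m) → (X, x₀)`. -/
structure LipLoop (x₀ : X) where
  toFun : CubeSpace m → X
  lipschitz : IsLipschitz toFun
  boundary : ∀ y ∈ Cube.boundary (Fin m), toFun y = x₀

variable {m} {x₀ : X}

/-- `f` and `g` are Lipschitz homotopic relative to the boundary of the cube: there is a homotopy
`H : [0,1]^m × [0,1] → X` from `f` to `g` that is (jointly) Lipschitz and maps
`∂[0,1]^m × [0,1]` to the base point. -/
def LipHomotopic (f g : LipLoop m x₀) : Prop :=
  ∃ H : CubeSpace m × unitInterval → X, IsLipschitz H ∧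
    (∀ y, H (y, 0) = f.toFun y) ∧ (∀ y, H (y, 1) = g.toFun y) ∧
    ∀ y ∈ Cube.boundary (Fin m), ∀ t, H (y, t) = x₀

theorem LipHomotopic.refl (f : LipLoop m x₀) : LipHomotopic f f :=
  ⟨fun p => f.toFun p.1, f.lipschitz.comp isLipschitz_fst, fun _ => rfl, fun _ => rfl,
    fun y hy _ => f.boundary y hy⟩

theorem LipHomotopic.symm {f g : LipLoop m x₀} (h : LipHomotopic f g) : LipHomotopic g f := by
  obtain ⟨H, hL, h0, h1, hb⟩ := h
  refine ⟨fun p => H (p.1, clamp (-1 * p.2 + 1)), ?_, fun y => ?_, fun y => ?_, fun y hy t => hb y hy _⟩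
  · exact hL.comp (isLipschitz_fst.prodMk ((isLipschitz_of_affine (-1) 1).comp isLipschitz_snd))
  · have e : clamp (-1 * ((0 : unitInterval) : ℝ) + 1) = 1 := clamp_of_ge (by norm_num)
    simp only [e, h1]
  · have e : clamp (-1 * ((1 : unitInterval) : ℝ) + 1) = 0 := clamp_of_le (by norm_num)
    simp only [e, h0]

theorem LipHomotopic.trans {f g h : LipLoop m x₀} (h₁ : LipHomotopic f g)
    (h₂ : LipHomotopic g h) : LipHomotopic f h := by
  obtain ⟨H, hL, h0, h1, hb⟩ := h₁
  obtain ⟨H', hL', h0', h1', hb'⟩ := h₂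
  refine ⟨fun p => if (p.2 : ℝ) ≤ 1 / 2 then H (p.1, clamp (2 * p.2 + 0))
    else H' (p.1, clamp (2 * p.2 + -1)), ?_, fun y => ?_, fun y => ?_, fun y hy t => ?_⟩
  · refine IsLipschitz.glue
      (hL.comp (isLipschitz_fst.prodMk ((isLipschitz_of_affine 2 0).comp isLipschitz_snd)))
      (hL'.comp (isLipschitz_fst.prodMk ((isLipschitz_of_affine 2 (-1)).comp isLipschitz_snd)))
      (fun p => (p.2 : ℝ)) ?_ (fun p => (p.1, clamp (1 / 2))) (fun p => ?_) (fun p => ?_)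
    · have := (LipschitzWith.subtype_val (Icc (0 : ℝ) 1)).comp
        (LipschitzWith.prod_snd (α := CubeSpace m) (β := unitInterval))
      rw [mul_one] at this
      exact this
    · rw [Prod.edist_eq, edist_self, max_eq_right zero_le, Subtype.edist_eq, coe_clamp]
      norm_num
    · have e1 : clamp (2 * (clamp (1 / 2) : ℝ) + 0) = 1 := by
        apply clamp_of_ge; rw [coe_clamp]; norm_num
      have e2 : clamp (2 * (clamp (1 / 2) : ℝ) + -1) = 0 := by
        apply clamp_of_le; rw [coe_clamp]; norm_num
      simp only [e1, e2, h1, h0']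
  · have e : clamp (2 * ((0 : unitInterval) : ℝ) + 0) = 0 := clamp_of_le (by norm_num)
    simp only [e]
    rw [if_pos (by norm_num), h0]
  · have e : clamp (2 * ((1 : unitInterval) : ℝ) + -1) = 1 := clamp_of_ge (by norm_num)
    simp only [e]
    rw [if_neg (by norm_num), h1']
  · dsimp only
    split_ifs
    · exact hb y hy _
    · exact hb' y hy _

theorem LipHomotopic.of_eq {f g : LipLoop m x₀} (h : ∀ y, f.toFun y = g.toFun y) :
    LipHomotopic f g := by
  have : f = g := by
    cases f; cases g; congr; exact funext h
  exact this ▸ LipHomotopic.refl _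

variable (m) in
/-- Lipschitz homotopy relative to the boundary is an equivalence relation. -/
instance lipSetoid (x₀ : X) : Setoid (LipLoop m x₀) :=
  ⟨LipHomotopic, LipHomotopic.refl, LipHomotopic.symm, LipHomotopic.trans⟩

end Defs

end LipHomotopy

open LipHomotopy in
/-- The `m`-th Lipschitz homotopy group `π_m^Lip(X, x₀)`: the set of Lipschitz maps
`([0,1]^m, ∂[0,1]^m) → (X, x₀)` modulo Lipschitz homotopies relative to the boundary. -/
def LipschitzHomotopyGroup (m : ℕ) (X : Type*) [PseudoEMetricSpace X] (x₀ : X) : Type _ :=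
  Quotient (lipSetoid m x₀)

namespace LipHomotopy

open Set

section GroupLaw

variable {m : ℕ} [NeZero m] {X : Type*} [PseudoEMetricSpace X] {x₀ : X}

/-- The class of the constant map. -/
def constLoop (m : ℕ) (x₀ : X) : LipLoop m x₀ :=
  ⟨fun _ => x₀, isLipschitz_const _, fun _ _ => rfl⟩

/-- Replace the first coordinate of a point of the cube. -/
def setFirst (x : CubeSpace m) (s : unitInterval) : CubeSpace m := Function.update x 0 s

theorem setFirst_zero (x : CubeSpace m) {s : unitInterval} (h : s = 0 ∨ s = 1) :
    setFirst x s ∈ Cube.boundary (Fin m) :=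
  ⟨0, by simpa [setFirst] using h⟩

theorem setFirst_self (x : CubeSpace m) : setFirst x (x 0) = x := by simp [setFirst]

theorem setFirst_apply_first (x : CubeSpace m) (s : unitInterval) : setFirst x s 0 = s := by
  simp [setFirst]

theorem setFirst_setFirst (x : CubeSpace m) (s t : unitInterval) :
    setFirst (setFirst x s) t = setFirst x t := by simp [setFirst]

/-- A boundary point stays in the boundary if its first coordinate is changed, unless it lies in
the boundary because of the first coordinate. -/
theorem setFirst_boundary {x : CubeSpace m} (hx : x ∈ Cube.boundary (Fin m)) (s : unitInterval)
    (h : x 0 = 0 ∨ x 0 = 1 → s = 0 ∨ s = 1) : setFirst x s ∈ Cube.boundary (Fin m) := by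
  obtain ⟨i, hi⟩ := hx
  by_cases h0 : i = 0
  · subst h0
    exact setFirst_zero x (h hi)
  · exact ⟨i, by simpa [setFirst, Function.update_of_ne h0] using hi⟩

theorem isLipschitz_setFirst {W : Type*} [PseudoEMetricSpace W] {f : W → CubeSpace m}
    {φ : W → unitInterval} (hf : IsLipschitz f) (hφ : IsLipschitz φ) :
    IsLipschitz fun w => setFirst (f w) (φ w) :=
  IsLipschitz.comp (f := fun p : CubeSpace m × unitInterval => Function.update p.1 0 p.2)
    (g := fun w => (f w, φ w)) (isLipschitz_update 0) (hf.prodMk hφ)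

/-- Gluing along the slice where the first coordinate is `1/2`. -/
theorem glueFirst {Z : Type*} [PseudoEMetricSpace Z] {f g : CubeSpace m × Z → X}
    (hf : IsLipschitz f) (hg : IsLipschitz g)
    (h : ∀ x z, x 0 = clamp (1 / 2) → f (x, z) = g (x, z)) :
    IsLipschitz fun p => if (p.1 0 : ℝ) ≤ 1 / 2 then f p else g p := by
  refine IsLipschitz.glue hf hg (fun p => (p.1 0 : ℝ)) ?_
    (fun p => (setFirst p.1 (clamp (1 / 2)), p.2)) (fun p => ?_) (fun p => ?_)
  · have := ((LipschitzWith.subtype_val (Icc (0 : ℝ) 1)).comp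
      (LipschitzWith.eval (α := fun _ : Fin m => unitInterval) (0 : Fin m))).comp
      (LipschitzWith.prod_fst (α := CubeSpace m) (β := Z))
    rw [mul_one, mul_one] at this
    exact this
  · rw [Prod.edist_eq, edist_self, max_eq_left zero_le, edist_pi_le_iff]
    intro i
    by_cases h0 : i = 0
    · subst h0
      simp only [setFirst_apply_first]
      rw [Subtype.edist_eq, coe_clamp]
      norm_num
    · simp [setFirst, Function.update_of_ne h0]
  · exact h _ _ (setFirst_apply_first _ _)

/-- The concatenation, in the first coordinate, of two maps on the cube: first `f`, then `g`. -/
def concat (f g : CubeSpace m → X) (x : CubeSpace m) : X :=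
  if (x 0 : ℝ) ≤ 1 / 2 then f (setFirst x (clamp (2 * x 0 + 0)))
  else g (setFirst x (clamp (2 * x 0 + -1)))

theorem concat_homotopy {f g : CubeSpace m × unitInterval → X} (hf : IsLipschitz f)
    (hg : IsLipschitz g) (hfb : ∀ y ∈ Cube.boundary (Fin m), ∀ t, f (y, t) = x₀)
    (hgb : ∀ y ∈ Cube.boundary (Fin m), ∀ t, g (y, t) = x₀) :
    IsLipschitz (fun p : CubeSpace m × unitInterval =>
      concat (fun x => f (x, p.2)) (fun x => g (x, p.2)) p.1) ∧
    ∀ y ∈ Cube.boundary (Fin m), ∀ t, concat (fun x => f (x, t)) (fun x => g (x, t)) y = x₀ := by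
  constructor
  · have e (a b : ℝ) : IsLipschitz fun p : CubeSpace m × unitInterval =>
        (setFirst p.1 (clamp (a * p.1 0 + b)), p.2) :=
      (isLipschitz_setFirst isLipschitz_fst
        ((isLipschitz_of_affine a b).comp ((isLipschitz_eval 0).comp isLipschitz_fst))).prodMk
        isLipschitz_snd
    refine glueFirst (f := fun p => f (setFirst p.1 (clamp (2 * p.1 0 + 0)), p.2))
      (g := fun p => g (setFirst p.1 (clamp (2 * p.1 0 + -1)), p.2))
      (hf.comp (e 2 0)) (hg.comp (e 2 (-1))) fun x t hx => ?_
    have e1 : clamp (2 * (clamp (1 / 2) : ℝ) + 0) = 1 := by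
      apply clamp_of_ge; rw [coe_clamp]; norm_num
    have e2 : clamp (2 * (clamp (1 / 2) : ℝ) + -1) = 0 := by
      apply clamp_of_le; rw [coe_clamp]; norm_num
    simp only [hx, e1, e2]
    rw [hfb _ (setFirst_zero x (Or.inr rfl)), hgb _ (setFirst_zero x (Or.inl rfl))]
  · intro y hy t
    unfold concat
    split_ifs with h
    · refine hfb _ (setFirst_boundary hy _ ?_) _
      rintro (h0 | h0)
      · exact Or.inl (clamp_of_le (by simp [h0]))
      · rw [h0] at h; norm_num at h
    · refine hgb _ (setFirst_boundary hy _ ?_) _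
      rintro (h0 | h0)
      · rw [h0] at h; norm_num at h
      · exact Or.inr (clamp_of_ge (by rw [h0]; norm_num))

/-- Concatenation of Lipschitz loops. -/
def LipLoop.mul (f g : LipLoop m x₀) : LipLoop m x₀ where
  toFun := concat f.toFun g.toFun
  lipschitz := (concat_homotopy (f.lipschitz.comp isLipschitz_fst)
    (g.lipschitz.comp isLipschitz_fst) (fun y hy _ => f.boundary y hy)
    (fun y hy _ => g.boundary y hy)).1.comp (isLipschitz_id.prodMk (isLipschitz_const 0))
  boundary y hy := (concat_homotopy (f.lipschitz.comp isLipschitz_fst)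
    (g.lipschitz.comp isLipschitz_fst) (fun y hy _ => f.boundary y hy)
    (fun y hy _ => g.boundary y hy)).2 y hy 0

theorem LipHomotopic.mul {f f' g g' : LipLoop m x₀} (h : LipHomotopic f f')
    (h' : LipHomotopic g g') : LipHomotopic (f.mul g) (f'.mul g') := by
  obtain ⟨H, hL, h0, h1, hb⟩ := h
  obtain ⟨H', hL', h0', h1', hb'⟩ := h'
  obtain ⟨a, b⟩ := concat_homotopy hL hL' hb hb'
  refine ⟨_, a, fun y => ?_, fun y => ?_, b⟩
  · simp only [h0, h0']; rfl
  · simp only [h1, h1']; rfl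

/-- A map of the interval that sends endpoints to endpoints. -/
structure Reparam where
  toFun : unitInterval → unitInterval
  lipschitz : IsLipschitz toFun
  zero : toFun 0 = 0 ∨ toFun 0 = 1
  one : toFun 1 = 0 ∨ toFun 1 = 1

/-- Reparametrization of a Lipschitz loop in its first coordinate. -/
def LipLoop.reparam (f : LipLoop m x₀) (φ : Reparam) : LipLoop m x₀ where
  toFun x := f.toFun (setFirst x (φ.toFun (x 0)))
  lipschitz := f.lipschitz.comp
    (isLipschitz_setFirst isLipschitz_id (φ.lipschitz.comp (isLipschitz_eval 0)))
  boundary y hy := f.boundary _ <| setFirst_boundary hy _ <| by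
    rintro (h | h) <;> rw [h]
    exacts [φ.zero, φ.one]

theorem LipLoop.reparam_homotopic (f : LipLoop m x₀) (φ ψ : Reparam)
    (h0 : φ.toFun 0 = ψ.toFun 0) (h1 : φ.toFun 1 = ψ.toFun 1) :
    LipHomotopic (f.reparam φ) (f.reparam ψ) := by
  let c : unitInterval → unitInterval → unitInterval := fun s t =>
    clamp (((clamp (-1 * t + 1) * φ.toFun s : unitInterval) : ℝ) + (t * ψ.toFun s : unitInterval))
  have hc : IsLipschitz fun p : CubeSpace m × unitInterval => c (p.1 0) p.2 := by
    have e : IsLipschitz fun p : CubeSpace m × unitInterval => p.1 0 :=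
      (isLipschitz_eval 0).comp isLipschitz_fst
    refine isLipschitz_clamp.comp (IsLipschitz.add ?_ ?_)
    · exact isLipschitz_coe.comp (isLipschitz_mul.comp
        (((isLipschitz_of_affine (-1) 1).comp isLipschitz_snd).prodMk (φ.lipschitz.comp e)))
    · exact isLipschitz_coe.comp (isLipschitz_mul.comp
        (isLipschitz_snd.prodMk (ψ.lipschitz.comp e)))
  have c0 : ∀ s, c s 0 = φ.toFun s := fun s => by
    have : clamp (-1 * ((0 : unitInterval) : ℝ) + 1) = 1 := clamp_of_ge (by norm_num)
    simp only [c, this]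
    simpa using clamp_coe (φ.toFun s)
  have c1 : ∀ s, c s 1 = ψ.toFun s := fun s => by
    have : clamp (-1 * ((1 : unitInterval) : ℝ) + 1) = 0 := clamp_of_le (by norm_num)
    simp only [c, this]
    simpa using clamp_coe (ψ.toFun s)
  have ce : ∀ s t, φ.toFun s = ψ.toFun s → c s t = φ.toFun s := fun s t h => by
    have ht : ((clamp (-1 * t + 1) : unitInterval) : ℝ) = 1 - t := by
      have h1 := t.2.1
      have h2 := t.2.2
      rw [coe_clamp, min_eq_right (by linarith), max_eq_right (by linarith)]
      ring
    have e : ((clamp (-1 * t + 1) * φ.toFun s : unitInterval) : ℝ) + (t * φ.toFun s : unitInterval)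
        = (φ.toFun s : ℝ) := by
      rw [Set.Icc.coe_mul, Set.Icc.coe_mul, ht]
      ring
    simp only [c, ← h]
    rw [e, clamp_coe]
  refine ⟨fun p => f.toFun (setFirst p.1 (c (p.1 0) p.2)),
    f.lipschitz.comp (isLipschitz_setFirst isLipschitz_fst hc), fun y => ?_, fun y => ?_,
    fun y hy t => f.boundary _ (setFirst_boundary hy _ ?_)⟩
  · simp only [c0]; rfl
  · simp only [c1]; rfl
  · rintro (h | h) <;> dsimp only <;> rw [h]
    · rw [ce _ _ h0]; exact φ.zero
    · rw [ce _ _ h1]; exact φ.one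

/-- The identity reparametrization. -/
def Reparam.id : Reparam := ⟨fun s => s, isLipschitz_id, Or.inl rfl, Or.inr rfl⟩

/-- The orientation-reversing reparametrization. -/
def Reparam.rev : Reparam :=
  ⟨fun s => clamp (-1 * s + 1), isLipschitz_of_affine _ _,
    Or.inr (clamp_of_ge (by norm_num)), Or.inl (clamp_of_le (by norm_num))⟩

/-- The inverse loop. -/
def LipLoop.inv (f : LipLoop m x₀) : LipLoop m x₀ := f.reparam Reparam.rev

theorem LipHomotopic.inv {f g : LipLoop m x₀} (h : LipHomotopic f g) :
    LipHomotopic f.inv g.inv := by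
  obtain ⟨H, hL, h0, h1, hb⟩ := h
  refine ⟨fun p => H (setFirst p.1 (Reparam.rev.toFun (p.1 0)), p.2),
    hL.comp ((isLipschitz_setFirst isLipschitz_fst (Reparam.rev.lipschitz.comp
      ((isLipschitz_eval 0).comp isLipschitz_fst))).prodMk isLipschitz_snd),
    fun y => h0 _, fun y => h1 _, fun y hy t => hb _ (setFirst_boundary hy _ ?_) t⟩
  rintro (h | h) <;> dsimp only <;> rw [h]
  exacts [Reparam.rev.zero, Reparam.rev.one]

theorem isLipschitz_min {W : Type*} [PseudoEMetricSpace W] {f g : W → ℝ} (hf : IsLipschitz f)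
    (hg : IsLipschitz g) : IsLipschitz fun x => min (f x) (g x) := by
  obtain ⟨K, hK⟩ := hf
  obtain ⟨L, hL⟩ := hg
  exact ⟨max K L, hK.min hL⟩

/-- The reparametrization that compares the two ways of concatenating three loops. -/
def Reparam.assoc : Reparam where
  toFun s := clamp (min (2 * (s : ℝ)) (min (s + 1 / 4) (1 / 2 * s + 1 / 2)))
  lipschitz := isLipschitz_clamp.comp (isLipschitz_min (isLipschitz_coe.const_mul 2)
    (isLipschitz_min (isLipschitz_coe.add (isLipschitz_const _))
      ((isLipschitz_coe.const_mul _).add (isLipschitz_const _))))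
  zero := Or.inl (clamp_of_le (by norm_num))
  one := Or.inr (clamp_of_ge (by norm_num))

theorem mul_assoc_homotopic (f g h : LipLoop m x₀) :
    LipHomotopic ((f.mul g).mul h) (f.mul (g.mul h)) := by
  refine (LipHomotopic.of_eq (g := (f.mul (g.mul h)).reparam Reparam.assoc) fun y => ?_).trans
    (((f.mul (g.mul h)).reparam_homotopic Reparam.assoc Reparam.id (clamp_of_le (by norm_num))
      (clamp_of_ge (by norm_num))).trans (LipHomotopic.of_eq fun y => ?_))
  · have p1 := (y 0).2.1
    have p2 := (y 0).2.2
    simp only [LipLoop.mul, LipLoop.reparam, concat, Reparam.assoc, setFirst_apply_first,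
      setFirst_setFirst, coe_clamp]
    generalize ((y 0 : unitInterval) : ℝ) = s at *
    rcases le_total s (1 / 4) with h1 | h1
    · have e1 : min (2 * s) (min (s + 1 / 4) (1 / 2 * s + 1 / 2)) = 2 * s :=
        min_eq_left (le_min (by linarith) (by linarith))
      rw [e1]
      have e2 : max 0 (min 1 (2 * s)) = 2 * s := by
        rw [min_eq_right (by linarith), max_eq_right (by linarith)]
      have e3 : max 0 (min 1 (2 * s + 0)) = 2 * s := by rw [add_zero, e2]
      rw [e2, e3, if_pos (by linarith), if_pos (by linarith), if_pos (by linarith)]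
    rcases le_total s (1 / 2) with h2 | h2
    · have e1 : min (2 * s) (min (s + 1 / 4) (1 / 2 * s + 1 / 2)) = s + 1 / 4 := by
        rw [min_eq_left (a := s + 1 / 4) (by linarith), min_eq_right (by linarith)]
      rw [e1]
      have e2 : max 0 (min 1 (s + 1 / 4)) = s + 1 / 4 := by
        rw [min_eq_right (by linarith), max_eq_right (by linarith)]
      have e3 : max 0 (min 1 (2 * s + 0)) = 2 * s := by
        rw [add_zero, min_eq_right (by linarith), max_eq_right (by linarith)]
      rw [e2, e3, if_pos h2]
      rcases h1.eq_or_lt with rfl | h1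
      · rw [if_pos (by norm_num), if_pos (by norm_num)]
        norm_num
      · rw [if_neg (by linarith), if_neg (by linarith)]
        have e4 : max 0 (min 1 (2 * (s + 1 / 4) + -1)) = 2 * s - 1 / 2 := by
          rw [min_eq_right (by linarith), max_eq_right (by linarith)]; ring
        rw [e4, if_pos (by linarith)]
        congr 3
        ring
    · have e1 : min (2 * s) (min (s + 1 / 4) (1 / 2 * s + 1 / 2)) = 1 / 2 * s + 1 / 2 := by
        rw [min_eq_right (a := s + 1 / 4) (by linarith), min_eq_right (by linarith)]
      rw [e1]
      have e2 : max 0 (min 1 (1 / 2 * s + 1 / 2)) = 1 / 2 * s + 1 / 2 := by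
        rw [min_eq_right (by linarith), max_eq_right (by linarith)]
      have e3 : max 0 (min 1 (2 * (1 / 2 * s + 1 / 2) + -1)) = s := by
        rw [min_eq_right (by linarith), max_eq_right (by linarith)]; ring
      rw [e2, e3, if_neg (c := 1 / 2 * s + 1 / 2 ≤ 1 / 2) (by linarith)]
      rcases h2.eq_or_lt with rfl | h2
      · norm_num
      · rw [if_neg (by linarith), if_neg (by linarith)]
  · simp only [LipLoop.reparam, Reparam.id, setFirst_self]

/-- The reparametrization `s ↦ 2s - 1`, with `[0, 1/2]` sent to `0`. -/
def Reparam.late : Reparam :=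
  ⟨fun s => clamp (2 * s + -1), isLipschitz_of_affine _ _,
    Or.inl (clamp_of_le (by norm_num)), Or.inr (clamp_of_ge (by norm_num))⟩

theorem one_mul_homotopic (f : LipLoop m x₀) : LipHomotopic ((constLoop m x₀).mul f) f := by
  refine (LipHomotopic.of_eq (g := f.reparam Reparam.late) fun y => ?_).trans
    ((f.reparam_homotopic Reparam.late Reparam.id (clamp_of_le (by norm_num))
      (clamp_of_ge (by norm_num))).trans (LipHomotopic.of_eq fun y => ?_))
  · simp only [LipLoop.mul, LipLoop.reparam, concat, Reparam.late, constLoop]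
    split_ifs with h
    · rw [clamp_of_le (by linarith), f.boundary _ (setFirst_zero y (Or.inl rfl))]
    · rfl
  · simp only [LipLoop.reparam, Reparam.id, setFirst_self]

/-- The reparametrization `s ↦ |2s - 1|`. -/
def Reparam.fold : Reparam where
  toFun s := clamp (-1 * min (2 * (s : ℝ) + -1) ((-2) * s + 1))
  lipschitz := isLipschitz_clamp.comp ((isLipschitz_min
    ((isLipschitz_coe.const_mul _).add (isLipschitz_const _))
    ((isLipschitz_coe.const_mul _).add (isLipschitz_const _))).const_mul _)
  zero := Or.inr (clamp_of_ge (by norm_num))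
  one := Or.inr (clamp_of_ge (by norm_num))

/-- The constant reparametrization. -/
def Reparam.const : Reparam := ⟨fun _ => 1, isLipschitz_const _, Or.inr rfl, Or.inr rfl⟩

theorem inv_mul_homotopic (f : LipLoop m x₀) : LipHomotopic (f.inv.mul f) (constLoop m x₀) := by
  refine (LipHomotopic.of_eq (g := f.reparam Reparam.fold) fun y => ?_).trans
    ((f.reparam_homotopic Reparam.fold Reparam.const (clamp_of_ge (by norm_num))
      (clamp_of_ge (by norm_num))).trans (LipHomotopic.of_eq fun y => ?_))
  · have p1 := (y 0).2.1
    simp only [LipLoop.inv, LipLoop.mul, LipLoop.reparam, concat, Reparam.fold, Reparam.rev,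
      setFirst_apply_first, setFirst_setFirst, coe_clamp]
    split_ifs with h
    · rw [min_eq_left (a := 2 * ((y 0 : unitInterval) : ℝ) + -1) (by linarith),
        min_eq_right (by linarith), max_eq_right (by linarith)]
      congr 3
      ring
    · rw [not_le] at h
      rw [min_eq_right (by linarith)]
      congr 3
      ring
  · exact f.boundary _ (setFirst_zero y (Or.inr rfl))

/-- The group structure on `π_m^Lip(X, x₀)`, `m ≥ 1`: the product is induced by concatenation in the
first coordinate, the unit is the class of the constant map. -/
instance : Group (LipschitzHomotopyGroup m X x₀) :=
  letI : Mul (LipschitzHomotopyGroup m X x₀) :=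
    ⟨Quotient.map₂ LipLoop.mul fun _ _ h _ _ h' => LipHomotopic.mul h h'⟩
  letI : Inv (LipschitzHomotopyGroup m X x₀) :=
    ⟨Quotient.map LipLoop.inv fun _ _ h => LipHomotopic.inv h⟩
  letI : One (LipschitzHomotopyGroup m X x₀) := ⟨Quotient.mk _ (constLoop m x₀)⟩
  Group.ofLeftAxioms
    (by
      rintro ⟨f⟩ ⟨g⟩ ⟨h⟩
      exact Quotient.sound (mul_assoc_homotopic f g h))
    (by
      rintro ⟨f⟩
      exact Quotient.sound (one_mul_homotopic f))
    (by
      rintro ⟨f⟩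
      exact Quotient.sound (inv_mul_homotopic f))

end GroupLaw

end LipHomotopy

/-! ### The Heisenberg group with its Carnot-Carathéodory metric -/

/-- The space `ℂⁿ × ℝ = ℝ^(2n+1)` of coordinates `(z, t)`, `z = x + iy`, with its usual real normed
space structure. -/
abbrev HeisCoord (n : ℕ) : Type := EuclideanSpace ℂ (Fin n) × ℝ

/-- The points of the Heisenberg group `ℍ_n`. This is a separate type from `ℂⁿ × ℝ`, since it
carries the Carnot-Carathéodory metric and not the Euclidean one. -/
@[ext]
structure Heisenberg (n : ℕ) where
  coord : HeisCoord n

namespace Heisenberg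

open Set MeasureTheory
open scoped ENNReal

variable {n : ℕ}

/-- The left invariant vector field `X_j = ∂/∂x_j + 2 y_j ∂/∂t`. -/
def vecX (j : Fin n) (p : HeisCoord n) : HeisCoord n :=
  (EuclideanSpace.single j 1, 2 * (p.1 j).im)

/-- The left invariant vector field `Y_j = ∂/∂y_j - 2 x_j ∂/∂t`. -/
def vecY (j : Fin n) (p : HeisCoord n) : HeisCoord n :=
  (EuclideanSpace.single j Complex.I, -2 * (p.1 j).re)

/-- The horizontal space at `p`, spanned by the `X_j(p)` and `Y_j(p)`. -/
def horizontalSpace (p : HeisCoord n) : Submodule ℝ (HeisCoord n) :=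
  Submodule.span ℝ (range (fun j => vecX j p) ∪ range (fun j => vecY j p))

/-- The length of a horizontal vector in the metric for which the `X_j(p)`, `Y_j(p)` are orthonormal.
Since the `z`-components of `X_j`, `Y_j` are the vectors `∂/∂x_j`, `∂/∂y_j`, it is the Euclidean
length of the `z`-component, see `horizontalLength_sum`. -/
def horizontalLength (v : HeisCoord n) : ℝ≥0∞ := ‖v.1‖ₑ

theorem horizontalLength_sum (p : HeisCoord n) (a b : Fin n → ℝ) :
    horizontalLength (∑ j, (a j • vecX j p + b j • vecY j p)) =
      ENNReal.ofReal (Real.sqrt (∑ j, (a j ^ 2 + b j ^ 2))) := by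
  have h : ∀ i, (∑ j, (a j • vecX j p + b j • vecY j p)).1 i = a i + b i * Complex.I := by
    intro i
    simp [Prod.fst_sum, vecX, vecY, Finset.sum_add_distrib, Pi.single_apply]
  rw [horizontalLength, ← ofReal_norm, EuclideanSpace.norm_eq]
  congr 2
  refine Finset.sum_congr rfl fun i _ => ?_
  rw [h, ← Complex.normSq_eq_norm_sq, Complex.normSq_add_mul_I]

/-- A horizontal curve from `p` to `q`: an absolutely continuous curve `γ : [a, b] → ℝ^(2n+1)` with
`γ(a) = p`, `γ(b) = q` and `γ'(s)` in the horizontal space at `γ(s)` for almost every `s`. The values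
of `γ` outside of `[a, b]` play no role. -/
structure HorizontalCurve (p q : Heisenberg n) where
  a : ℝ
  b : ℝ
  le : a ≤ b
  curve : ℝ → HeisCoord n
  absCont : AbsolutelyContinuousOnInterval curve a b
  horizontal : ∀ᵐ s : ℝ, s ∈ Ioo a b →
    DifferentiableAt ℝ curve s ∧ deriv curve s ∈ horizontalSpace (curve s)
  source : curve a = p.coord
  target : curve b = q.coord

/-- The length of a horizontal curve. -/
def HorizontalCurve.length {p q : Heisenberg n} (c : HorizontalCurve p q) : ℝ≥0∞ :=
  ∫⁻ s in Ioo c.a c.b, horizontalLength (deriv c.curve s)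

/-- The Carnot-Carathéodory distance: the infimum of the lengths of the horizontal curves that
connect two points. -/
def ccDist (p q : Heisenberg n) : ℝ≥0∞ := ⨅ c : HorizontalCurve p q, c.length

theorem ac_comp {E : Type*} [PseudoMetricSpace E] {f : ℝ → E} {a b c d : ℝ} (hab : a ≤ b)
    (hcd : c ≤ d) (hf : AbsolutelyContinuousOnInterval f a b) (φ : ℝ → ℝ)
    (hφ : Monotone φ ∨ Antitone φ) (hL : ∀ x y, dist (φ x) (φ y) ≤ dist x y)
    (hm : ∀ x ∈ Icc c d, φ x ∈ Icc a b) :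
    AbsolutelyContinuousOnInterval (fun s => f (φ s)) c d := by
  rw [absolutelyContinuousOnInterval_iff] at hf ⊢
  intro ε hε
  obtain ⟨δ, hδ, H⟩ := hf ε hε
  refine ⟨δ, hδ, fun E hE hs => ?_⟩
  refine H (E.1, fun i => (φ (E.2 i).1, φ (E.2 i).2)) ⟨?_, ?_⟩
    (lt_of_le_of_lt (Finset.sum_le_sum fun i _ => hL _ _) hs)
  · intro i hi
    have := hE.1 i hi
    rw [uIcc_of_le hcd] at this
    rw [uIcc_of_le hab]
    exact ⟨hm _ this.1, hm _ this.2⟩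
  · intro i hi j hj hij
    have h := hE.2 hi hj hij
    simp only [Function.onFun, uIoc] at h ⊢
    rw [Ioc_disjoint_Ioc] at h ⊢
    rcases hφ with m | m
    · have h' := m h
      simpa only [m.map_min, m.map_max] using h'
    · have h' := m h
      simpa only [m.map_min, m.map_max] using h'

theorem ac_glue {E : Type*} [PseudoMetricSpace E] {f g : ℝ → E} {a b c : ℝ}
    (hab : a ≤ b) (hbc : b ≤ c) (hf : AbsolutelyContinuousOnInterval f a b)
    (hg : AbsolutelyContinuousOnInterval g b c) (hfg : f b = g b) :
    AbsolutelyContinuousOnInterval (fun s => if s ≤ b then f s else g s) a c := by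
  have h1 : AbsolutelyContinuousOnInterval (fun s => f (min s b)) a c :=
    ac_comp hab (hab.trans hbc) hf (fun s => min s b)
      (Or.inl fun x y h => min_le_min_right b h)
      (fun x y => by
        have := abs_min_sub_min_le_max x b y b
        simpa [Real.dist_eq] using this)
      (fun x hx => ⟨le_min hx.1 hab, min_le_right _ _⟩)
  have h2 : AbsolutelyContinuousOnInterval (fun s => g (max s b)) a c :=
    ac_comp hbc (hab.trans hbc) hg (fun s => max s b)
      (Or.inl fun x y h => max_le_max_right b h)
      (fun x y => by
        have := abs_max_sub_max_le_max x b y b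
        simpa [Real.dist_eq] using this)
      (fun x hx => ⟨le_max_right _ _, max_le hx.2 hbc⟩)
  have key : ∀ x y : ℝ, dist (if x ≤ b then f x else g x) (if y ≤ b then f y else g y) ≤
      dist (f (min x b)) (f (min y b)) + dist (g (max x b)) (g (max y b)) := by
    intro x y
    split_ifs with hx hy hy
    · simp [hx, hy]
    · have hy' := (not_le.1 hy).le
      rw [min_eq_left hx, min_eq_right hy', max_eq_right hx, max_eq_left hy', ← hfg]
      exact (dist_triangle _ (f b) _).trans_eq (by rw [hfg])
    · have hx' := (not_le.1 hx).le
      rw [min_eq_left hy, min_eq_right hx', max_eq_right hy, max_eq_left hx', add_comm, hfg]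
      exact dist_triangle _ _ _
    · have hx' := (not_le.1 hx).le
      have hy' := (not_le.1 hy).le
      simp [hx', hy']
  unfold AbsolutelyContinuousOnInterval at h1 h2 ⊢
  refine squeeze_zero (fun E => Finset.sum_nonneg fun _ _ => dist_nonneg) (fun E => ?_)
    (by simpa using h1.add h2)
  rw [← Finset.sum_add_distrib]
  exact Finset.sum_le_sum fun i _ => key _ _

namespace HorizontalCurve

variable {p q r : Heisenberg n}

/-- The constant curve. -/
def const (p : Heisenberg n) : HorizontalCurve p p where
  a := 0
  b := 0
  le := le_rfl
  curve := fun _ => p.coord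
  absCont := ((LipschitzWith.const p.coord).lipschitzOnWith).absolutelyContinuousOnInterval
  horizontal := by simp
  source := rfl
  target := rfl

theorem length_const (p : Heisenberg n) : (const p).length = 0 := by
  simp [length, const]

/-- The reversed curve. -/
def rev (c : HorizontalCurve p q) : HorizontalCurve q p where
  a := -c.b
  b := -c.a
  le := neg_le_neg c.le
  curve := fun s => c.curve (-s)
  absCont := ac_comp c.le (neg_le_neg c.le) c.absCont (fun s => -s)
    (Or.inr fun x y h => neg_le_neg h) (fun x y => by rw [dist_neg_neg])
    (fun x hx => ⟨by linarith [hx.2], by linarith [hx.1]⟩)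
  horizontal := by
    filter_upwards [(Measure.measurePreserving_neg (volume : Measure ℝ)).quasiMeasurePreserving.ae
      c.horizontal] with s hs hm
    obtain ⟨h1, h2⟩ := hs ⟨by linarith [hm.2], by linarith [hm.1]⟩
    refine ⟨h1.comp s differentiable_neg.differentiableAt, ?_⟩
    rw [deriv_comp_neg]
    exact Submodule.neg_mem _ h2
  source := by rw [neg_neg, c.target]
  target := by rw [neg_neg, c.source]

theorem length_rev (c : HorizontalCurve p q) : c.rev.length = c.length := by
  have := (Measure.measurePreserving_neg (volume : Measure ℝ)).setLIntegral_comp_preimage_emb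
    (MeasurableEquiv.neg ℝ).measurableEmbedding
    (fun s => horizontalLength (deriv c.curve s)) (Ioo c.a c.b)
  rw [length, length, ← this]
  have e : (Neg.neg ⁻¹' Ioo c.a c.b : Set ℝ) = Ioo (-c.b) (-c.a) := by simp
  simp only [rev]
  rw [← e]
  refine lintegral_congr fun s => ?_
  rw [deriv_comp_neg, horizontalLength, horizontalLength, Prod.fst_neg, enorm_neg]

/-- The curve with a shifted parameter. -/
def shift (c : HorizontalCurve p q) (τ : ℝ) : HorizontalCurve p q where
  a := c.a - τ
  b := c.b - τ
  le := by linarith [c.le]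
  curve := fun s => c.curve (s + τ)
  absCont := ac_comp c.le (by linarith [c.le]) c.absCont (fun s => s + τ)
    (Or.inl fun x y h => by dsimp only; linarith) (fun x y => by rw [dist_add_right])
    (fun x hx => ⟨by linarith [hx.1], by linarith [hx.2]⟩)
  horizontal := by
    filter_upwards [(measurePreserving_add_right (volume : Measure ℝ) τ).quasiMeasurePreserving.ae
      c.horizontal] with s hs hm
    obtain ⟨h1, h2⟩ := hs ⟨by linarith [hm.1], by linarith [hm.2]⟩
    refine ⟨h1.comp s (by fun_prop), ?_⟩
    rw [deriv_comp_add_const]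
    exact h2
  source := by rw [sub_add_cancel, c.source]
  target := by rw [sub_add_cancel, c.target]

theorem length_shift (c : HorizontalCurve p q) (τ : ℝ) : (c.shift τ).length = c.length := by
  have := (measurePreserving_add_right (volume : Measure ℝ) τ).setLIntegral_comp_preimage_emb
    (measurableEmbedding_addRight τ)
    (fun s => horizontalLength (deriv c.curve s)) (Ioo c.a c.b)
  rw [length, length, ← this]
  have e : ((fun x => x + τ) ⁻¹' Ioo c.a c.b : Set ℝ) = Ioo (c.a - τ) (c.b - τ) := by simp
  simp only [shift]
  rw [← e]
  refine lintegral_congr fun s => ?_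
  rw [deriv_comp_add_const]

theorem glue_eventuallyEq_left {E : Type*} {f g : ℝ → E} {b s : ℝ} (h : s < b) :
    (fun s => if s ≤ b then f s else g s) =ᶠ[nhds s] f := by
  filter_upwards [eventually_lt_nhds h] with u hu
  rw [if_pos hu.le]

theorem glue_eventuallyEq_right {E : Type*} {f g : ℝ → E} {b s : ℝ} (h : b < s) :
    (fun s => if s ≤ b then f s else g s) =ᶠ[nhds s] g := by
  filter_upwards [eventually_gt_nhds h] with u hu
  rw [if_neg (not_le.2 hu)]

/-- The concatenation of two curves whose parameter intervals are adjacent. -/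
def trans (c : HorizontalCurve p q) (d : HorizontalCurve q r) (h : d.a = c.b) :
    HorizontalCurve p r where
  a := c.a
  b := d.b
  le := c.le.trans (h ▸ d.le)
  curve := fun s => if s ≤ c.b then c.curve s else d.curve s
  absCont := ac_glue c.le (h ▸ d.le) c.absCont (h ▸ d.absCont) (by rw [c.target, ← h, d.source])
  horizontal := by
    have hne : ∀ᵐ s : ℝ, s ≠ c.b := by simp [ae_iff]
    filter_upwards [c.horizontal, d.horizontal, hne] with s hc hd hs hm
    rcases lt_or_gt_of_ne hs with h1 | h1
    · have e := glue_eventuallyEq_left (f := c.curve) (g := d.curve) h1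
      rw [e.deriv_eq, e.eq_of_nhds, e.differentiableAt_iff]
      exact hc ⟨hm.1, h1⟩
    · have e := glue_eventuallyEq_right (f := c.curve) (g := d.curve) h1
      rw [e.deriv_eq, e.eq_of_nhds, e.differentiableAt_iff]
      exact hd ⟨h ▸ h1, hm.2⟩
  source := by rw [if_pos c.le, c.source]
  target := by
    split_ifs with hb
    · have e : d.b = c.b := le_antisymm hb (h ▸ d.le)
      rw [e, c.target, ← d.source, ← d.target, h, e]
    · exact d.target

theorem length_trans_le (c : HorizontalCurve p q) (d : HorizontalCurve q r) (h : d.a = c.b) :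
    (c.trans d h).length ≤ c.length + d.length := by
  have hs : Ioo c.a d.b ⊆ (Ioo c.a c.b ∪ Ioo d.a d.b) ∪ {c.b} := by
    intro s hs
    rcases lt_trichotomy s c.b with h1 | h1 | h1
    · exact Or.inl (Or.inl ⟨hs.1, h1⟩)
    · exact Or.inr h1
    · exact Or.inl (Or.inr ⟨h ▸ h1, hs.2⟩)
  calc (c.trans d h).length
      ≤ ∫⁻ s in (Ioo c.a c.b ∪ Ioo d.a d.b) ∪ {c.b},
          horizontalLength (deriv (c.trans d h).curve s) := lintegral_mono_set hs
    _ ≤ (∫⁻ s in Ioo c.a c.b ∪ Ioo d.a d.b, horizontalLength (deriv (c.trans d h).curve s)) +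
          ∫⁻ s in {c.b}, horizontalLength (deriv (c.trans d h).curve s) := lintegral_union_le _ _ _
    _ = ∫⁻ s in Ioo c.a c.b ∪ Ioo d.a d.b, horizontalLength (deriv (c.trans d h).curve s) := by
        rw [Measure.restrict_singleton]; simp
    _ ≤ (∫⁻ s in Ioo c.a c.b, horizontalLength (deriv (c.trans d h).curve s)) +
          ∫⁻ s in Ioo d.a d.b, horizontalLength (deriv (c.trans d h).curve s) :=
        lintegral_union_le _ _ _
    _ = c.length + d.length := by
        congr 1
        · refine setLIntegral_congr_fun measurableSet_Ioo fun s hs => ?_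
          exact congrArg horizontalLength
            (glue_eventuallyEq_left (f := c.curve) (g := d.curve) hs.2).deriv_eq
        · refine setLIntegral_congr_fun measurableSet_Ioo fun s hs => ?_
          exact congrArg horizontalLength
            (glue_eventuallyEq_right (f := c.curve) (g := d.curve) (h ▸ hs.1)).deriv_eq

end HorizontalCurve

/-- `ℍ_n` with the Carnot-Carathéodory distance. (That this distance is finite and separates points
is a theorem, which is not needed to speak of Lipschitz maps.) -/
instance : PseudoEMetricSpace (Heisenberg n) where
  edist := ccDist
  edist_self p := le_antisymm
    ((iInf_le _ (HorizontalCurve.const p)).trans_eq (HorizontalCurve.length_const p)) zero_le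
  edist_comm := by
    have h : ∀ p q : Heisenberg n, ccDist p q ≤ ccDist q p := fun p q =>
      le_iInf fun c => (iInf_le _ c.rev).trans_eq c.length_rev
    exact fun p q => le_antisymm (h p q) (h q p)
  edist_triangle p q r := by
    refine ENNReal.le_iInf_add_iInf ?_
    intro c d
    have e : (d.shift (d.a - c.b)).a = c.b := by simp [HorizontalCurve.shift]
    refine (iInf_le _ (c.trans (d.shift (d.a - c.b)) e)).trans ?_
    exact (HorizontalCurve.length_trans_le _ _ e).trans_eq (by rw [HorizontalCurve.length_shift])

end Heisenberg

/-! ### Rank-essential homotopy groups of spheres -/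

/-- The Euclidean unit sphere `𝕊^k` in `ℝ^(k+1)`. -/
abbrev Sph (k : ℕ) : Type := Metric.sphere (0 : EuclideanSpace ℝ (Fin (k + 1))) 1

instance finrankEuclideanFact (k : ℕ) :
    Fact (Module.finrank ℝ (EuclideanSpace ℝ (Fin (k + 1))) = k + 1) :=
  ⟨finrank_euclideanSpace_fin⟩

/-- `π_m(𝕊^n)` is rank-essential: there is a smooth map `f : 𝕊^m → 𝕊^n` such that every Lipschitz
extension `F : 𝔹^(m+1) → ℝ^(n+1)` of `f` to the closed unit ball has a derivative of rank `n + 1` on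
a set of positive measure. -/
def RankEssential (m n : ℕ) : Prop :=
  ∃ f : Sph m → Sph n, ContMDiff (𝓡 m) (𝓡 n) ∞ f ∧
    ∀ F : EuclideanSpace ℝ (Fin (m + 1)) → EuclideanSpace ℝ (Fin (n + 1)),
      (∃ K, LipschitzOnWith K F (Metric.closedBall 0 1)) →
      (∀ x : Sph m, F x = f x) →
      0 < MeasureTheory.volume {x ∈ Metric.ball (0 : EuclideanSpace ℝ (Fin (m + 1))) 1 |
        DifferentiableAt ℝ F x ∧ 
          Module.finrank ℝ (LinearMap.range (fderiv ℝ F x).toLinearMap) = n + 1}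

end

/-!
The Heisenberg group `ℍ_n` contains a Legendrian copy of `𝕊^n`: the lift `whitney` of the Whitney
sphere `(σ, x) ↦ (1 + iσ)x`. Curves on it are horizontal, so a smooth map `f : 𝕊^m → 𝕊^n` induces a
Lipschitz loop `sphereLoop` in `ℍ_n`, which left translation moves to any base point. The polynomial
map `whitneyInv` retracts `ℂⁿ × ℝ` back to `ℝ^(n+1)`, with `whitneyInv ∘ whitney = id` on the sphere.

Suppose that the loop of a rank-essential `f` is Lipschitz null homotopic. The homotopy lives on
`[0,1]^m × [0,1]`; precomposed with a Lipschitz map from the ball to this cube, and followed by the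
retraction, it gives a Lipschitz map from the inner half of the unit ball to `ℝ^(n+1)`. Its boundary
values are `f` precomposed with a map homotopic to the identity of `𝕊^m`. That homotopy, run on the
collar `1/2 ≤ ‖x‖ ≤ 1`, turns it into a Lipschitz extension `F` of `f` to the ball
(`exists_extension_of_homotopic`).

The rank of `dF` is at most `n` almost everywhere, which contradicts the choice of `f`. On the collar
this holds because `F` takes values in `𝕊^n`. On the inner half, `F` factors through a Lipschitz map
`(z, t)` to `ℍ_n`. The Carnot-Carathéodory distance `d` satisfies `|z' - z| ≤ d` and
`|t' - t - 2 ω(z, z')| ≤ 2 d²` for the symplectic form `ω` of `ℂⁿ`. By Rademacher's theorem `z` is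
differentiable almost everywhere, and a blow-up at such a point (`symp_fderiv_eq_zero`) shows that
the image of `dz` is isotropic, hence of dimension at most `n`. Since `dt = 2 ω(z, dz)`, this bounds
the rank of `d(z, t)` (`finrank_range_fderiv_comp_le`).
-/

noncomputable section

open Set MeasureTheory Filter Topology
open scoped ENNReal

/-! ### The symplectic form and the horizontal spaces -/

namespace Heisenberg

variable {n : ℕ}

/-- The standard symplectic form `ω(z, w) = ∑ j, (Im z_j Re w_j - Re z_j Im w_j)` of `ℂⁿ`, as a real
linear form in `w`. The sign is the one for which the horizontal vectors at `(z, t)` are the `(w, s)`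
with `s = 2 ω(z, w)`. -/
def symp (z : EuclideanSpace ℂ (Fin n)) : EuclideanSpace ℂ (Fin n) →L[ℝ] ℝ :=
  -(Complex.imCLM.comp ((innerSL ℂ z).restrictScalars ℝ))

theorem symp_apply (z w : EuclideanSpace ℂ (Fin n)) : symp z w = -(inner ℂ z w).im := rfl

theorem symp_eq_sum (z w : EuclideanSpace ℂ (Fin n)) :
    symp z w = ∑ j, ((z j).im * (w j).re - (z j).re * (w j).im) := by
  simp only [symp_apply, PiLp.inner_apply, RCLike.inner_apply, Complex.im_sum, Complex.mul_im,
    Complex.conj_re, Complex.conj_im, ← Finset.sum_neg_distrib]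
  exact Finset.sum_congr rfl fun j _ => by ring

theorem symp_add_left (z z' w : EuclideanSpace ℂ (Fin n)) :
    symp (z + z') w = symp z w + symp z' w := by
  simp only [symp_apply, inner_add_left, Complex.add_im]; ring

theorem symp_sub_left (z z' w : EuclideanSpace ℂ (Fin n)) :
    symp (z - z') w = symp z w - symp z' w := by
  simp only [symp_apply, inner_sub_left, Complex.sub_im]; ring

theorem symp_smul_left (c : ℝ) (z w : EuclideanSpace ℂ (Fin n)) :
    symp (c • z) w = c * symp z w := by
  simp only [symp_eq_sum, Finset.mul_sum]
  refine Finset.sum_congr rfl fun j _ => ?_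
  simp only [PiLp.smul_apply, Complex.smul_re, Complex.smul_im, smul_eq_mul]
  ring

theorem symp_swap (z w : EuclideanSpace ℂ (Fin n)) : symp w z = -symp z w := by
  simp only [symp_eq_sum, ← Finset.sum_neg_distrib]
  exact Finset.sum_congr rfl fun j _ => by ring

theorem symp_self (z : EuclideanSpace ℂ (Fin n)) : symp z z = 0 := by
  simp only [symp_eq_sum]
  exact Finset.sum_eq_zero fun j _ => by ring

theorem abs_symp_le (z w : EuclideanSpace ℂ (Fin n)) : |symp z w| ≤ ‖z‖ * ‖w‖ := by
  rw [symp_apply, abs_neg]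
  exact (Complex.abs_im_le_norm _).trans (norm_inner_le_norm z w)

theorem symp_I_smul (z : EuclideanSpace ℂ (Fin n)) : symp z (Complex.I • z) = -‖z‖ ^ 2 := by
  rw [symp_apply, inner_smul_right, inner_self_eq_norm_sq_to_K]
  simp [← Complex.ofReal_pow]

theorem mem_horizontalSpace_iff (p v : HeisCoord n) :
    v ∈ horizontalSpace p ↔ v.2 = 2 * symp p.1 v.1 := by
  constructor
  · intro h
    induction h using Submodule.span_induction with
    | mem x hx =>
      rcases hx with ⟨j, rfl⟩ | ⟨j, rfl⟩
      · simp [vecX, symp_eq_sum, apply_ite Complex.re, apply_ite Complex.im]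
      · simp [vecY, symp_eq_sum, apply_ite Complex.re, apply_ite Complex.im]
    | zero => simp
    | add x y _ _ hx hy => simp [hx, hy, mul_add]
    | smul a x _ hx => simp [hx, mul_left_comm]
  · intro h
    have e : v = ∑ j, ((v.1 j).re • vecX j p + (v.1 j).im • vecY j p) := by
      refine Prod.ext ?_ ?_
      · ext i
        simp [Prod.fst_sum, vecX, vecY, Finset.sum_add_distrib, Pi.single_apply,
          Complex.re_add_im]
      · rw [h, symp_eq_sum]
        simp only [Prod.snd_sum, vecX, vecY, Prod.snd_add, Prod.smul_snd, smul_eq_mul,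
          Finset.mul_sum]
        exact Finset.sum_congr rfl fun j _ => by ring
    rw [e]
    refine Submodule.sum_mem _ fun j _ => Submodule.add_mem _ ?_ ?_
    · exact Submodule.smul_mem _ _ (Submodule.subset_span (Or.inl ⟨j, rfl⟩))
    · exact Submodule.smul_mem _ _ (Submodule.subset_span (Or.inr ⟨j, rfl⟩))

end Heisenberg

/-! ### Absolutely continuous curves -/

theorem AbsolutelyContinuousOnInterval.lipschitz_comp {X Y : Type*} [PseudoMetricSpace X]
    [PseudoMetricSpace Y] {f : ℝ → X} {a b : ℝ} {g : X → Y} {K : NNReal} (hg : LipschitzWith K g)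
    (hf : AbsolutelyContinuousOnInterval f a b) :
    AbsolutelyContinuousOnInterval (fun s => g (f s)) a b := by
  have h : Tendsto _ _ _ := hf
  unfold AbsolutelyContinuousOnInterval
  refine squeeze_zero (fun E => Finset.sum_nonneg fun _ _ => dist_nonneg) (fun E => ?_)
    (by simpa using h.const_mul (K : ℝ))
  rw [Finset.mul_sum]
  exact Finset.sum_le_sum fun i _ => hg.dist_le_mul _ _

theorem AbsolutelyContinuousOnInterval.enorm_sub_le_lintegral {E : Type*} [NormedAddCommGroup E]
    [NormedSpace ℝ E] {f : ℝ → E} {a b : ℝ} (hab : a ≤ b)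
    (hf : AbsolutelyContinuousOnInterval f a b)
    (hd : ∀ᵐ s : ℝ, s ∈ Ioo a b → DifferentiableAt ℝ f s) :
    ‖f b - f a‖ₑ ≤ ∫⁻ s in Ioo a b, ‖deriv f s‖ₑ := by
  obtain ⟨g, hg, hgx⟩ := exists_dual_vector'' ℝ (f b - f a)
  have h := (hf.lipschitz_comp g.lipschitz).integral_deriv_eq_sub
  rw [← map_sub, hgx, intervalIntegral.integral_of_le hab, integral_Ioc_eq_integral_Ioo] at h
  have e : ‖f b - f a‖ₑ = ‖‖f b - f a‖‖ₑ := (enorm_norm _).symm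
  rw [e]
  change _ = ‖f b - f a‖ at h
  rw [← h]
  refine (enorm_integral_le_lintegral_enorm _).trans (lintegral_mono_ae ?_)
  rw [ae_restrict_iff' measurableSet_Ioo]
  filter_upwards [hd] with s hs hm
  have e2 : deriv (fun s => g (f s)) s = g (deriv f s) :=
    (g.hasFDerivAt.comp_hasDerivAt s (hs hm).hasDerivAt).deriv
  rw [e2, ← ofReal_norm, ← ofReal_norm]
  exact ENNReal.ofReal_le_ofReal ((g.le_opNorm _).trans
    ((mul_le_mul_of_nonneg_right hg (norm_nonneg _)).trans_eq (one_mul _)))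

namespace Heisenberg

variable {n : ℕ}

/-! ### Comparison of the Carnot-Carathéodory distance with the coordinates -/

theorem HorizontalCurve.enorm_fst_sub_le {p q : Heisenberg n} (c : HorizontalCurve p q) {s : ℝ}
    (hs : s ∈ Icc c.a c.b) : ‖(c.curve s).1 - p.coord.1‖ₑ ≤ c.length := by
  have h := AbsolutelyContinuousOnInterval.enorm_sub_le_lintegral (f := fun s => (c.curve s).1)
    hs.1 ((c.absCont.mono (by
      rw [uIcc_of_le hs.1, uIcc_of_le c.le]
      exact Icc_subset_Icc_right hs.2)).lipschitz_comp LipschitzWith.prod_fst) (by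
      filter_upwards [c.horizontal] with u hu hm
      exact (hu ⟨hm.1, hm.2.trans_le hs.2⟩).1.fst)
  rw [c.source] at h
  refine h.trans (le_trans (lintegral_mono_ae ?_)
    (lintegral_mono_set (Ioo_subset_Ioo_right hs.2)))
  rw [ae_restrict_iff' measurableSet_Ioo]
  filter_upwards [c.horizontal] with u hu hm
  have e : deriv (fun s => (c.curve s).1) u = (deriv c.curve u).1 :=
    
    (((ContinuousLinearMap.fst ℝ (EuclideanSpace ℂ (Fin n)) ℝ).hasFDerivAt).comp_hasDerivAt u
      (hu ⟨hm.1, hm.2.trans_le hs.2⟩).1.hasDerivAt).deriv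
  rw [e, horizontalLength]

/-- Along a horizontal curve `(z, t)` from `p = (z₀, t₀)`, the function `t - 2 ω(z₀, z)` has derivative
`2 ω(z - z₀, z')`, and `z - z₀` is bounded by the length of the curve. -/
theorem HorizontalCurve.enorm_vertical_le {p q : Heisenberg n} (c : HorizontalCurve p q) :
    ‖q.coord.2 - p.coord.2 - 2 * symp p.coord.1 q.coord.1‖ₑ ≤ 2 * c.length ^ 2 := by
  let g : HeisCoord n →L[ℝ] ℝ := ContinuousLinearMap.snd ℝ _ _ -
    (2 : ℝ) • (symp p.coord.1).comp (ContinuousLinearMap.fst ℝ _ _)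
  have hg : ∀ v, g v = v.2 - 2 * symp p.coord.1 v.1 := fun v => by simp [g]
  have h := AbsolutelyContinuousOnInterval.enorm_sub_le_lintegral (f := fun s => g (c.curve s))
    c.le (c.absCont.lipschitz_comp g.lipschitz) (by
      filter_upwards [c.horizontal] with u hu hm
      exact g.differentiableAt.comp u (hu hm).1)
  rw [c.source, c.target, hg, hg, symp_self] at h
  have e0 : q.coord.2 - p.coord.2 - 2 * symp p.coord.1 q.coord.1 =
    q.coord.2 - 2 * symp p.coord.1 q.coord.1 - (p.coord.2 - 2 * 0) := by ring
  rw [e0]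
  refine h.trans ?_
  have hm : Measurable fun s => horizontalLength (deriv c.curve s) := by
    unfold horizontalLength
    exact (measurable_deriv c.curve).fst.enorm
  calc _ ≤ ∫⁻ s in Ioo c.a c.b, (2 * c.length) * horizontalLength (deriv c.curve s) := by
        refine lintegral_mono_ae ?_
        rw [ae_restrict_iff' measurableSet_Ioo]
        filter_upwards [c.horizontal] with u hu hm
        have e : deriv (fun s => g (c.curve s)) u = g (deriv c.curve u) :=
          (g.hasFDerivAt.comp_hasDerivAt u (hu hm).1.hasDerivAt).deriv
        rw [e, hg, (mem_horizontalSpace_iff _ _).1 (hu hm).2, ← mul_sub, ← symp_sub_left,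
          enorm_mul, horizontalLength, mul_assoc]
        have e2 : ‖(2 : ℝ)‖ₑ = 2 := by
          rw [Real.enorm_of_nonneg (by norm_num)]; norm_num
        rw [e2]
        gcongr
        calc _ ≤ ‖(c.curve u).1 - p.coord.1‖ₑ * ‖(deriv c.curve u).1‖ₑ := by
              rw [← ofReal_norm, ← ofReal_norm, ← ofReal_norm,
                ← ENNReal.ofReal_mul (norm_nonneg _)]
              exact ENNReal.ofReal_le_ofReal (abs_symp_le _ _)
          _ ≤ _ := by
              gcongr
              exact c.enorm_fst_sub_le (Ioo_subset_Icc_self hm)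
    _ = 2 * c.length * c.length := by rw [lintegral_const_mul _ hm]; rfl
    _ = 2 * c.length ^ 2 := by ring

theorem enorm_fst_sub_le_edist (p q : Heisenberg n) :
    ‖q.coord.1 - p.coord.1‖ₑ ≤ edist p q := by
  refine le_iInf fun c => ?_
  have := c.enorm_fst_sub_le (right_mem_Icc.2 c.le)
  rwa [c.target] at this

theorem enorm_vertical_le_edist (p q : Heisenberg n) :
    ‖q.coord.2 - p.coord.2 - 2 * symp p.coord.1 q.coord.1‖ₑ ≤ 2 * edist p q ^ 2 := by
  have hc : Continuous fun x : ℝ≥0∞ => 2 * x ^ 2 :=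
    (ENNReal.continuous_const_mul (by simp)).comp (ENNReal.continuous_pow 2)
  have hm : Monotone fun x : ℝ≥0∞ => 2 * x ^ 2 := fun x y hxy => by
    dsimp only
    gcongr
  have h := hm.map_iInf_of_continuousAt (g := fun c : HorizontalCurve p q => c.length)
    hc.continuousAt (by simp)
  have h' : ‖q.coord.2 - p.coord.2 - 2 * symp p.coord.1 q.coord.1‖ₑ ≤
      ⨅ c : HorizontalCurve p q, 2 * c.length ^ 2 := le_iInf fun c => c.enorm_vertical_le
  exact h'.trans_eq h.symm

/-- The Carnot-Carathéodory distance between the endpoints of a horizontal curve on `[0, 1]` is at most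
its Lipschitz constant for the sup norm of `ℂⁿ × ℝ`. -/
theorem edist_le_of_lipschitz_horizontal {γ : ℝ → HeisCoord n} {K : NNReal}
    (hγ : LipschitzWith K γ) (h : ∀ᵐ s : ℝ, DifferentiableAt ℝ γ s ∧
      (deriv γ s).2 = 2 * symp (γ s).1 (deriv γ s).1) :
    edist (⟨γ 0⟩ : Heisenberg n) ⟨γ 1⟩ ≤ K := by
  let c : HorizontalCurve (⟨γ 0⟩ : Heisenberg n) ⟨γ 1⟩ :=
    { a := 0, b := 1, le := zero_le_one, curve := γ
      absCont := hγ.lipschitzOnWith.absolutelyContinuousOnInterval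
      horizontal := by
        filter_upwards [h] with s hs _
        exact ⟨hs.1, (mem_horizontalSpace_iff _ _).2 hs.2⟩
      source := rfl, target := rfl }
  refine (iInf_le _ c).trans ?_
  calc c.length ≤ ∫⁻ s in Ioo (0 : ℝ) 1, K := by
        refine lintegral_mono fun s => ?_
        rw [horizontalLength, ← ofReal_norm, ← ENNReal.ofReal_coe_nnreal]
        exact ENNReal.ofReal_le_ofReal ((norm_fst_le _).trans (norm_deriv_le_of_lipschitz hγ))
    _ = K := by simp

/-! ### Isotropy of the derivative of a Lipschitz map into the Heisenberg group -/

section Isotropy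

variable {E : Type*} [NormedAddCommGroup E] [NormedSpace ℝ E]

/-- The linear case of the isotropy: the hypothesis says that `p ↦ (L p, τ p)` obeys the vertical
estimate of a Lipschitz map into `ℍ_n`. Then `τ` has vanishing derivative along all rays from `0`, so
it is constant, and `ω(L p, L q)` is quadratically small in `q - p`. -/
theorem symp_eq_zero_of_quadratic {L : E →L[ℝ] EuclideanSpace ℂ (Fin n)} {τ : E → ℝ} {C : ℝ}
    (hτ : ∀ p q, |τ q - τ p - 2 * symp (L p) (L q)| ≤ C * ‖q - p‖ ^ 2) (v w : E) :
    symp (L v) (L w) = 0 := by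
  -- a function on the line whose increments are quadratically small is constant
  have key : ∀ f : ℝ → ℝ, ∀ D : ℝ, (∀ s r, |f r - f s| ≤ D * |r - s| ^ 2) → f 1 = f 0 := by
    intro f D hf
    have hd : ∀ s, HasDerivAt f 0 s := by
      intro s
      rw [hasDerivAt_iff_isLittleO]
      simp only [smul_zero, sub_zero]
      refine Asymptotics.IsBigO.trans_isLittleO (g := fun r => (r - s) ^ 2)
        (Asymptotics.IsBigO.of_bound D (Eventually.of_forall fun r => ?_)) ?_
      · simpa using hf s r
      · simpa using Asymptotics.isLittleO_pow_sub_sub s one_lt_two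
    exact is_const_of_deriv_eq_zero (fun s => (hd s).differentiableAt) (fun s => (hd s).deriv) 1 0
  have hconst : ∀ u, τ u = τ 0 := by
    intro u
    have := key (fun s => τ (s • u)) (C * ‖u‖ ^ 2) fun s r => by
      have := hτ (s • u) (r • u)
      simp only [map_smul, symp_smul_left, symp_self, smul_eq_mul, mul_zero, sub_zero, ← sub_smul,
        norm_smul, Real.norm_eq_abs] at this
      calc _ ≤ _ := this
        _ = _ := by ring
    simpa using this
  have := key (fun s => 2 * (s * symp (L v) (L w))) (C * ‖w‖ ^ 2) ?_
  · simpa using this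
  intro s r
  have := hτ v (v + (r - s) • w)
  rw [hconst, hconst v, sub_self, zero_sub, abs_neg, map_add, map_add, symp_self, map_smul,
    map_smul, zero_add, add_sub_cancel_left, norm_smul, Real.norm_eq_abs, smul_eq_mul] at this
  calc _ = |2 * ((r - s) * symp (L v) (L w))| := by congr 1; ring
    _ ≤ _ := this
    _ = _ := by ring

/-- At every point where the `z`-component of a Lipschitz map into `ℍ_n` is differentiable, its
derivative has isotropic image. The proof is a blow-up: under the parabolic rescaling the
`z`-components converge to `L`, while the `t`-components stay bounded and converge along an
ultrafilter. -/
theorem symp_fderiv_eq_zero {z : E → EuclideanSpace ℂ (Fin n)} {t : E → ℝ} {C : ℝ} {x : E}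
    {L : E →L[ℝ] EuclideanSpace ℂ (Fin n)} (hz : HasFDerivAt z L x)
    (ht : ∀ p q, |t q - t p - 2 * symp (z p) (z q)| ≤ C * ‖q - p‖ ^ 2) (v w : E) :
    symp (L v) (L w) = 0 := by
  -- the coordinates after the left translation that moves `(z x, t x)` to the origin
  let z' : E → EuclideanSpace ℂ (Fin n) := fun u => z u - z x
  let t' : E → ℝ := fun u => t u - t x - 2 * symp (z x) (z u)
  have ht' : ∀ p q, |t' q - t' p - 2 * symp (z' p) (z' q)| ≤ C * ‖q - p‖ ^ 2 := by
    intro p q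
    have e : t' q - t' p - 2 * symp (z' p) (z' q) = t q - t p - 2 * symp (z p) (z q) := by
      simp only [t', z', symp_sub_left, map_sub, symp_self, symp_swap (z x) (z p)]
      ring
    rw [e]
    exact ht p q
  -- parabolic rescaling
  let zε : ℝ → E → EuclideanSpace ℂ (Fin n) := fun ε u => ε⁻¹ • z' (x + ε • u)
  let tε : ℝ → E → ℝ := fun ε u => (ε⁻¹) ^ 2 * t' (x + ε • u)
  have htε : ∀ ε, 0 < ε → ∀ p q,
      |tε ε q - tε ε p - 2 * symp (zε ε p) (zε ε q)| ≤ C * ‖q - p‖ ^ 2 := by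
    intro ε hε p q
    have e : tε ε q - tε ε p - 2 * symp (zε ε p) (zε ε q) = (ε⁻¹) ^ 2 *
        (t' (x + ε • q) - t' (x + ε • p) - 2 * symp (z' (x + ε • p)) (z' (x + ε • q))) := by
      simp only [tε, zε, symp_smul_left, map_smul, smul_eq_mul]
      ring
    rw [e, abs_mul, abs_of_nonneg (by positivity)]
    refine (mul_le_mul_of_nonneg_left (ht' _ _) (by positivity)).trans_eq ?_
    rw [add_sub_add_left_eq_sub, ← smul_sub, norm_smul, Real.norm_of_nonneg hε.le]
    field_simp
  have hzε : ∀ u, Tendsto (fun ε => zε ε u) (𝓝[>] 0) (𝓝 (L u)) := by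
    intro u
    have := (hz.hasLineDerivAt u).tendsto_slope_zero_right
    simpa [zε, z'] using this
  let U : Ultrafilter ℝ := Ultrafilter.of (𝓝[>] (0 : ℝ))
  have hU : (U : Filter ℝ) ≤ 𝓝[>] 0 := Ultrafilter.of_le _
  have hlim : ∀ u, ∃ a, Tendsto (fun ε => tε ε u) U (𝓝 a) := by
    intro u
    have hb : ∀ᶠ ε in (U : Filter ℝ), tε ε u ∈ Metric.closedBall (0 : ℝ) (C * ‖u‖ ^ 2) := by
      filter_upwards [hU self_mem_nhdsWithin] with ε hε
      have := htε ε hε 0 u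
      have e : zε ε 0 = 0 := by simp [zε, z']
      have e' : tε ε 0 = 0 := by simp [tε, t', symp_self]
      rw [e', e, symp_apply, inner_zero_left] at this
      simpa using this
    obtain ⟨a, -, ha⟩ := (isCompact_closedBall (0 : ℝ) (C * ‖u‖ ^ 2)).ultrafilter_le_nhds
      (U.map fun ε => tε ε u) (by
        rw [Ultrafilter.coe_map, le_principal_iff, mem_map]
        exact hb)
    exact ⟨a, ha⟩
  choose τ hτ using hlim
  refine symp_eq_zero_of_quadratic (τ := τ) (C := C) (fun p q => ?_) v w
  have hs : Tendsto (fun ε => symp (zε ε p) (zε ε q)) U (𝓝 (symp (L p) (L q))) := by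
    have := ((hzε p).mono_left hU).inner (𝕜 := ℂ) ((hzε q).mono_left hU)
    exact ((Complex.continuous_im.tendsto _).comp this).neg
  refine le_of_tendsto (((hτ q).sub (hτ p)).sub (hs.const_mul 2)).abs ?_
  filter_upwards [hU self_mem_nhdsWithin] with ε hε
  exact htε ε hε p q

/-- An isotropic real subspace `V` of `ℂⁿ` has dimension at most `n`, since `iV` meets it only in `0`. -/
theorem finrank_le_of_isotropic (V : Submodule ℝ (EuclideanSpace ℂ (Fin n)))
    (hV : ∀ v ∈ V, ∀ w ∈ V, symp v w = 0) : Module.finrank ℝ V ≤ n := by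
  let J : EuclideanSpace ℂ (Fin n) ≃ₗ[ℝ] EuclideanSpace ℂ (Fin n) :=
    (LinearEquiv.smulOfNeZero ℂ _ Complex.I Complex.I_ne_zero).restrictScalars ℝ
  have hd : Disjoint V (V.map J.toLinearMap) := by
    rw [Submodule.disjoint_def]
    rintro _ h1 ⟨v, hv, rfl⟩
    have := hV v hv _ h1
    have e : J v = Complex.I • v := rfl
    simp only [LinearEquiv.coe_coe, e, symp_I_smul] at this ⊢
    have : v = 0 := by simpa using this
    simp [this]
  have h := Submodule.finrank_add_finrank_le_of_disjoint hd
  rw [LinearEquiv.finrank_map_eq J V] at h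
  have e : Module.finrank ℝ (EuclideanSpace ℂ (Fin n)) = 2 * n := by
    rw [finrank_real_of_complex, finrank_euclideanSpace_fin]
  omega

/-- The `t`-component of a Lipschitz map into `ℍ_n` is differentiable wherever the `z`-component is, and
the derivative of the map is horizontal there. -/
theorem hasFDerivAt_vertical {z : E → EuclideanSpace ℂ (Fin n)} {t : E → ℝ} {C : ℝ} {x : E}
    {L : E →L[ℝ] EuclideanSpace ℂ (Fin n)} (hz : HasFDerivAt z L x)
    (ht : ∀ p q, |t q - t p - 2 * symp (z p) (z q)| ≤ C * ‖q - p‖ ^ 2) :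
    HasFDerivAt t ((2 : ℝ) • (symp (z x)).comp L) x := by
  have h1 : HasFDerivAt (fun u => 2 * symp (z x) (z u)) ((2 : ℝ) • (symp (z x)).comp L) x :=
    ((symp (z x)).hasFDerivAt.comp x hz).const_smul (2 : ℝ)
  have h2 : HasFDerivAt (fun u => t u - 2 * symp (z x) (z u)) (0 : E →L[ℝ] ℝ) x := by
    rw [hasFDerivAt_iff_isLittleO]
    refine Asymptotics.IsBigO.trans_isLittleO (g := fun u => ‖u - x‖ ^ 2)
      (Asymptotics.IsBigO.of_bound C (Eventually.of_forall fun u => ?_)) ?_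
    · have e : t u - 2 * symp (z x) (z u) - (t x - 2 * symp (z x) (z x)) -
          (0 : E →L[ℝ] ℝ) (u - x) = t u - t x - 2 * symp (z x) (z u) := by
        simp [symp_self]; ring
      rw [e]
      simpa using ht x u
    · exact Asymptotics.isLittleO_pow_sub_sub x one_lt_two
  refine (zero_add ((2 : ℝ) • (symp (z x)).comp L) ▸ h2.add h1).congr_of_eventuallyEq
    (Eventually.of_forall fun u => ?_)
  simp

/-- A Lipschitz map `(z, t)` into `ℍ_n` has rank at most `n` wherever `z` is differentiable, also after
composition with a differentiable map of `ℂⁿ × ℝ`. -/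
theorem finrank_range_fderiv_comp_le {E' : Type*} [NormedAddCommGroup E'] [NormedSpace ℝ E']
    {z : E → EuclideanSpace ℂ (Fin n)} {t : E → ℝ} {C : ℝ} {x : E} (hz : DifferentiableAt ℝ z x)
    (ht : ∀ p q, |t q - t p - 2 * symp (z p) (z q)| ≤ C * ‖q - p‖ ^ 2)
    {P : HeisCoord n → E'} (hP : DifferentiableAt ℝ P (z x, t x)) :
    Module.finrank ℝ (LinearMap.range (fderiv ℝ (fun u => P (z u, t u)) x).toLinearMap) ≤ n := by
  obtain ⟨L, hL⟩ := hz
  have hg : HasFDerivAt (fun u => (z u, t u)) (L.prod ((2 : ℝ) • (symp (z x)).comp L)) x :=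
    hL.prodMk (hasFDerivAt_vertical hL ht)
  have hc := (HasFDerivAt.comp x hP.hasFDerivAt hg).fderiv
  have e : (fderiv ℝ P (z x, t x)).comp (L.prod ((2 : ℝ) • (symp (z x)).comp L)) =
      ((fderiv ℝ P (z x, t x)).comp
        ((ContinuousLinearMap.id ℝ _).prod ((2 : ℝ) • symp (z x)))).comp L := by
    ext v
    simp
  rw [e] at hc
  change fderiv ℝ (fun u => P (z u, t u)) x = _ at hc
  rw [hc, ContinuousLinearMap.toLinearMap_comp, LinearMap.range_comp]
  refine (Submodule.finrank_map_le _ _).trans (finrank_le_of_isotropic _ ?_)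
  rintro _ ⟨v, rfl⟩ _ ⟨w, rfl⟩
  exact symp_fderiv_eq_zero hL ht v w

end Isotropy

end Heisenberg

/-! ### Constructions of Lipschitz maps -/

namespace LipHomotopy

theorem IsLipschitz.locallyLipschitzOn_comp {Y V W : Type*} [PseudoEMetricSpace Y]
    [CompactSpace Y] [PseudoMetricSpace V] [PseudoMetricSpace W] {g : Y → V} {h : V → W}
    {s : Set V} (hg : IsLipschitz g) (hh : LocallyLipschitzOn s h) (hs : ∀ y, g y ∈ s) :
    IsLipschitz fun y => h (g y) := by
  obtain ⟨K, hK⟩ := hg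
  obtain ⟨L, hL⟩ := (hh.mono (range_subset_iff.2 hs)).exists_lipschitzOnWith_of_compact
    (isCompact_range hK.continuous)
  refine ⟨L * K, ?_⟩
  rw [← lipschitzOnWith_univ] at hK ⊢
  exact hL.comp hK fun y _ => mem_range_self y

theorem IsLipschitz.contDiff_comp {Y V W : Type*} [PseudoEMetricSpace Y] [CompactSpace Y]
    [NormedAddCommGroup V] [NormedSpace ℝ V] [NormedAddCommGroup W] [NormedSpace ℝ W]
    {g : Y → V} {h : V → W} (hg : IsLipschitz g) (hh : ContDiff ℝ 1 h) :
    IsLipschitz fun y => h (g y) :=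
  hg.locallyLipschitzOn_comp (s := univ) (locallyLipschitzOn_univ.2 hh.locallyLipschitz)
    fun _ => mem_univ _

theorem isLipschitz_pi {W : Type*} [PseudoEMetricSpace W] {ι : Type*} [Fintype ι] {Z : Type*}
    [PseudoEMetricSpace Z] {g : W → ι → Z} (h : ∀ i, IsLipschitz fun w => g w i) :
    IsLipschitz g := by
  choose K hK using h
  refine ⟨∑ i, K i, fun x y => edist_pi_le_iff.2 fun i => (hK i x y).trans ?_⟩
  gcongr
  exact Finset.single_le_sum (fun _ _ => zero_le) (Finset.mem_univ i)

theorem isLipschitz_toLp {W ι : Type*} [PseudoEMetricSpace W] [Fintype ι] {g : W → ι → ℝ}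
    (h : ∀ i, IsLipschitz fun w => g w i) :
    IsLipschitz fun w => (WithLp.toLp 2 (g w) : EuclideanSpace ℝ ι) :=
  IsLipschitz.comp ⟨_, PiLp.lipschitzWith_toLp 2 fun _ : ι => ℝ⟩ (isLipschitz_pi h)

end LipHomotopy

namespace Heisenberg

open LipHomotopy

variable {n : ℕ}

/-! ### Coordinates of Lipschitz maps into the Heisenberg group -/

section Coordinates

variable {Y : Type*} [PseudoMetricSpace Y] {g : Y → Heisenberg n} {K : NNReal}

theorem lipschitzWith_coord_fst : LipschitzWith 1 fun p : Heisenberg n => p.coord.1 := by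
  intro p q
  rw [ENNReal.coe_one, one_mul, edist_comm, edist_eq_enorm_sub]
  exact enorm_fst_sub_le_edist p q

theorem abs_vertical_le_of_lipschitzWith (hg : LipschitzWith K g) (x y : Y) :
    |(g y).coord.2 - (g x).coord.2 - 2 * symp (g x).coord.1 (g y).coord.1| ≤
      2 * K ^ 2 * dist x y ^ 2 := by
  have h := (enorm_vertical_le_edist (g x) (g y)).trans
    (mul_le_mul_right (pow_le_pow_left' (hg x y) 2) 2)
  have e : (2 : ℝ≥0∞) * (K * edist x y) ^ 2 = ENNReal.ofReal (2 * K ^ 2 * dist x y ^ 2) := by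
    rw [edist_dist, ENNReal.ofReal_mul (by positivity), ENNReal.ofReal_mul (by positivity),
      ENNReal.ofReal_pow (by positivity), ENNReal.ofReal_pow (by positivity),
      ENNReal.ofReal_coe_nnreal, mul_pow, mul_assoc]
    norm_num
  rw [e, ← ofReal_norm, ENNReal.ofReal_le_ofReal_iff (by positivity)] at h
  exact h

/-- On a compact space, Lipschitz maps into `ℍ_n` are Lipschitz for the usual norm of `ℂⁿ × ℝ`. -/
theorem isLipschitz_coord_comp [CompactSpace Y] (hg : IsLipschitz g) :
    IsLipschitz fun y => (g y).coord := by
  obtain ⟨K, hK⟩ := hg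
  have hz : LipschitzWith K fun y => (g y).coord.1 := by
    have := lipschitzWith_coord_fst.comp hK
    rwa [one_mul] at this
  obtain ⟨R, hR⟩ := (isCompact_range hz.continuous).isBounded.exists_norm_le
  obtain ⟨D, hD⟩ := Metric.isBounded_iff.1 (isCompact_univ (X := Y)).isBounded
  refine IsLipschitz.prodMk (f := fun y => (g y).coord.1) (g := fun y => (g y).coord.2) ⟨K, hz⟩
    ⟨_, LipschitzWith.of_dist_le_mul (K := (2 * |R| * K + 2 * K ^ 2 * |D|).toNNReal)
      fun y x => ?_⟩
  rw [Real.coe_toNNReal _ (by positivity), Real.dist_eq, dist_comm]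
  have h1 := abs_vertical_le_of_lipschitzWith hK x y
  have h2 : |symp (g x).coord.1 (g y).coord.1| ≤ |R| * (K * dist x y) := by
    calc _ = |symp (g x).coord.1 ((g y).coord.1 - (g x).coord.1)| := by
          rw [map_sub, symp_self, sub_zero]
      _ ≤ ‖(g x).coord.1‖ * ‖(g y).coord.1 - (g x).coord.1‖ := abs_symp_le _ _
      _ ≤ |R| * (K * dist x y) := by
          gcongr
          · exact (hR _ (mem_range_self x)).trans (le_abs_self R)
          · rw [← dist_eq_norm, dist_comm]
            exact hz.dist_le_mul x y
  have h3 : dist x y ≤ |D| := (hD (mem_univ x) (mem_univ y)).trans (le_abs_self D)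
  have h4 : 2 * (K : ℝ) ^ 2 * dist x y ^ 2 ≤ 2 * K ^ 2 * |D| * dist x y := by
    rw [pow_two (dist x y), mul_assoc _ |D|]
    gcongr
  calc |(g y).coord.2 - (g x).coord.2|
      = |((g y).coord.2 - (g x).coord.2 - 2 * symp (g x).coord.1 (g y).coord.1) +
          2 * symp (g x).coord.1 (g y).coord.1| := by congr 1; ring
    _ ≤ _ := abs_add_le _ _
    _ ≤ 2 * K ^ 2 * |D| * dist x y + 2 * (|R| * (K * dist x y)) := by
        rw [abs_mul, abs_two]
        gcongr
        exact h1.trans h4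
    _ = _ := by ring

end Coordinates

/-! ### A Legendrian sphere with a polynomial retraction -/

/-- The group law of `ℍ_n`, in coordinates. The inverse of `a` is `-a`. -/
def leftMul (a v : HeisCoord n) : HeisCoord n := (a.1 + v.1, a.2 + v.2 + 2 * symp a.1 v.1)

theorem leftMul_neg_leftMul (a v : HeisCoord n) : leftMul (-a) (leftMul a v) = v := by
  refine Prod.ext ?_ ?_
  · simp [leftMul]
  · have : symp (-a.1) = -symp a.1 := by
      ext w
      simp [symp_apply]
    simp only [leftMul, Prod.fst_neg, Prod.snd_neg, this, neg_apply, map_add,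
      symp_self]
    ring

theorem contDiff_leftMul (a : HeisCoord n) {k : ℕ∞ω} : ContDiff ℝ k (leftMul a) := by
  unfold leftMul
  fun_prop

theorem exists_leftMul_eq (p v : HeisCoord n) : ∃ a, leftMul a v = p :=
  ⟨(p.1 - v.1, p.2 - v.2 - 2 * symp p.1 v.1),
    Prod.ext (by simp [leftMul]) (by simp only [leftMul, symp_sub_left, symp_self]; ring)⟩

/-- Left translations map horizontal curves to horizontal curves. -/
theorem hasDerivAt_leftMul (a : HeisCoord n) {γ : ℝ → HeisCoord n} {v : HeisCoord n} {s : ℝ}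
    (h : HasDerivAt γ v s) (hv : v.2 = 2 * symp (γ s).1 v.1) :
    ∃ w, HasDerivAt (fun s => leftMul a (γ s)) w s ∧ w.2 = 2 * symp (leftMul a (γ s)).1 w.1 := by
  have h1 : HasDerivAt (fun s => (γ s).1) v.1 s :=
    ((ContinuousLinearMap.fst ℝ (EuclideanSpace ℂ (Fin n)) ℝ).hasFDerivAt).comp_hasDerivAt s h
  have h2 : HasDerivAt (fun s => (γ s).2) v.2 s :=
    ((ContinuousLinearMap.snd ℝ (EuclideanSpace ℂ (Fin n)) ℝ).hasFDerivAt).comp_hasDerivAt s h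
  have h3 : HasDerivAt (fun s => symp a.1 (γ s).1) (symp a.1 v.1) s :=
    (symp a.1).hasFDerivAt.comp_hasDerivAt s h1
  refine ⟨(v.1, v.2 + 2 * symp a.1 v.1),
    (h1.const_add a.1).prodMk ((h2.const_add a.2).add (h3.const_mul 2)), ?_⟩
  simp only [leftMul, hv, symp_add_left]
  ring

/-- The Legendrian lift to `ℂⁿ × ℝ` of the Whitney sphere `(σ, x) ↦ (1 + iσ)x`, where `w = (σ, x)` lies
in `ℝ × ℝⁿ`. On the unit sphere, `|x|² = 1 - σ²` gives `2 ω(z, dz) = -2 (1 - σ²) dσ`, which is the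
differential of the `t`-component. The Whitney sphere has a double point (the poles `σ = ±1`),
which the lift separates. -/
def whitney (w : EuclideanSpace ℝ (Fin (n + 1))) : HeisCoord n :=
  (WithLp.toLp 2 fun j => ⟨w j.succ, w 0 * w j.succ⟩, -2 * (w 0 - w 0 ^ 3 / 3))

/-- A polynomial left inverse of `whitney` on the unit sphere: `x` is the real part of `z`, and `σ` is
obtained from `-(3/2) t = 3σ - σ³` and `Re z · Im z = σ (1 - σ²) = σ - σ³`. -/
def whitneyInv (v : HeisCoord n) : EuclideanSpace ℝ (Fin (n + 1)) :=
  WithLp.toLp 2 (Fin.cons ((-(3 / 2) * v.2 - ∑ j, (v.1 j).re * (v.1 j).im) / 2)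
    fun j => (v.1 j).re)

theorem sum_succ_sq {w : EuclideanSpace ℝ (Fin (n + 1))} (hw : ‖w‖ = 1) :
    ∑ j : Fin n, w j.succ ^ 2 = 1 - w 0 ^ 2 := by
  have := EuclideanSpace.real_norm_sq_eq w
  rw [hw, Fin.sum_univ_succ] at this
  linarith

theorem whitneyInv_whitney {w : EuclideanSpace ℝ (Fin (n + 1))} (hw : ‖w‖ = 1) :
    whitneyInv (whitney w) = w := by
  ext i
  refine Fin.cases ?_ (fun j => ?_) i
  · have e : ∑ j : Fin n, w j.succ * (w 0 * w j.succ) = w 0 * (1 - w 0 ^ 2) := by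
      rw [← sum_succ_sq hw, Finset.mul_sum]
      exact Finset.sum_congr rfl fun j _ => by ring
    simp only [whitneyInv, whitney, Fin.cons_zero, e]
    ring
  · simp [whitneyInv, whitney]

theorem contDiff_whitney {k : ℕ∞ω} : ContDiff ℝ k (whitney (n := n)) := by
  refine ContDiff.prodMk ?_ (by fun_prop)
  rw [contDiff_piLp]
  intro j
  have e : (fun w : EuclideanSpace ℝ (Fin (n + 1)) => (⟨w j.succ, w 0 * w j.succ⟩ : ℂ)) =
      fun w => Complex.equivRealProdCLM.symm (w j.succ, w 0 * w j.succ) := rfl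
  change ContDiff ℝ k fun w : EuclideanSpace ℝ (Fin (n + 1)) => (⟨w j.succ, w 0 * w j.succ⟩ : ℂ)
  rw [e]
  exact Complex.equivRealProdCLM.symm.contDiff.comp (by fun_prop)

theorem contDiff_whitneyInv {k : ℕ∞ω} : ContDiff ℝ k (whitneyInv (n := n)) := by
  have hc (j : Fin n) : ContDiff ℝ k fun v : HeisCoord n => v.1 j := by fun_prop
  have hre (j : Fin n) : ContDiff ℝ k fun v : HeisCoord n => (v.1 j).re :=
    Complex.reCLM.contDiff.comp (hc j)
  have him (j : Fin n) : ContDiff ℝ k fun v : HeisCoord n => (v.1 j).im :=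
    Complex.imCLM.contDiff.comp (hc j)
  rw [contDiff_piLp]
  intro i
  refine Fin.cases ?_ (fun j => ?_) i
  · simp only [whitneyInv, Fin.cons_zero]
    exact ((contDiff_snd.const_smul (-(3 / 2) : ℝ)).sub
      (ContDiff.sum fun j _ => (hre j).mul (him j))).div_const 2
  · simpa only [whitneyInv, Fin.cons_succ] using hre j

theorem hasDerivAt_whitney {w : ℝ → EuclideanSpace ℝ (Fin (n + 1))} {s : ℝ}
    (hw : DifferentiableAt ℝ w s) (h1 : ‖w s‖ = 1) :
    ∃ v, HasDerivAt (fun s => whitney (w s)) v s ∧ v.2 = 2 * symp (whitney (w s)).1 v.1 := by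
  obtain ⟨v, hv⟩ : ∃ v, HasDerivAt (fun s => whitney (w s)) v s :=
    ⟨_, (((contDiff_whitney (k := 1)).differentiable one_ne_zero).differentiableAt.comp s
      hw).hasDerivAt⟩
  refine ⟨v, hv, ?_⟩
  have hcoord (i : Fin (n + 1)) : HasDerivAt (fun s => w s i) (deriv w s i) s :=
    (EuclideanSpace.proj (𝕜 := ℝ) i).hasFDerivAt.comp_hasDerivAt s hw.hasDerivAt
  have hz (j : Fin n) : HasDerivAt (fun s => (whitney (w s)).1 j) (v.1 j) s :=
    (((EuclideanSpace.proj (𝕜 := ℂ) j).restrictScalars ℝ).comp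
      (ContinuousLinearMap.fst ℝ (EuclideanSpace ℂ (Fin n)) ℝ)).hasFDerivAt.comp_hasDerivAt s hv
  have hre (j : Fin n) : (v.1 j).re = deriv w s j.succ :=
    (Complex.reCLM.hasFDerivAt.comp_hasDerivAt s (hz j)).unique (hcoord j.succ)
  have him (j : Fin n) : (v.1 j).im = deriv w s 0 * w s j.succ + w s 0 * deriv w s j.succ :=
    (Complex.imCLM.hasFDerivAt.comp_hasDerivAt s (hz j)).unique
      ((hcoord 0).mul (hcoord j.succ))
  have ht : v.2 = -2 * (deriv w s 0 - 3 * w s 0 ^ 2 * deriv w s 0 / 3) := by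
    have h := (ContinuousLinearMap.snd ℝ (EuclideanSpace ℂ (Fin n)) ℝ).hasFDerivAt.comp_hasDerivAt
      s hv
    refine h.unique ?_
    exact (((hcoord 0).sub (((hcoord 0).pow 3).div_const 3)).const_mul (-2)).congr_deriv
      (by norm_num)
  have e : symp (whitney (w s)).1 v.1 = -deriv w s 0 * ∑ j : Fin n, w s j.succ ^ 2 := by
    rw [symp_eq_sum, Finset.mul_sum]
    refine Finset.sum_congr rfl fun j _ => ?_
    rw [hre, him]
    simp only [whitney]
    ring
  rw [e, ht, sum_succ_sq h1]
  ring

/-- The images of segments under `β` are mapped to horizontal curves by a left translate of `whitney`;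
this bounds the Carnot-Carathéodory distance. -/
theorem isLipschitz_leftMul_whitney {V : Type*} [NormedAddCommGroup V] [NormedSpace ℝ V]
    {β : V → EuclideanSpace ℝ (Fin (n + 1))} (hβ : IsLipschitz β) (h1 : ∀ y, ‖β y‖ = 1)
    (a : HeisCoord n) : IsLipschitz fun y => (⟨leftMul a (whitney (β y))⟩ : Heisenberg n) := by
  obtain ⟨K, hK⟩ := hβ
  have hL : LocallyLipschitzOn (Metric.sphere 0 1) fun w => leftMul a (whitney (n := n) w) :=
    (((contDiff_leftMul a (k := 1)).comp contDiff_whitney).locallyLipschitz).locallyLipschitzOn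
  obtain ⟨L, hL⟩ := hL.exists_lipschitzOnWith_of_compact (isCompact_sphere _ _)
  have hΨ : LipschitzWith (L * K) fun y => leftMul a (whitney (β y)) := by
    rw [← lipschitzOnWith_univ] at hK ⊢
    exact hL.comp hK fun y _ => by simp [h1]
  refine ⟨L * K, fun x y => ?_⟩
  have hc : LipschitzWith (‖y - x‖₊) fun s : ℝ => x + s • (y - x) := by
    refine LipschitzWith.of_dist_le_mul fun s r => ?_
    rw [dist_add_left, dist_eq_norm, ← sub_smul, norm_smul, mul_comm]
    rfl
  have h := edist_le_of_lipschitz_horizontal (hΨ.comp hc) (by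
    filter_upwards [(hK.comp hc).ae_differentiableAt (μ := volume)] with s hs
    obtain ⟨v, hv, hv'⟩ := hasDerivAt_whitney hs (h1 _)
    obtain ⟨u, hu, hu'⟩ := hasDerivAt_leftMul a hv hv'
    refine ⟨hu.differentiableAt, ?_⟩
    have e : deriv ((fun y => leftMul a (whitney (β y))) ∘ fun s => x + s • (y - x)) s = u :=
      hu.deriv
    rw [e]
    exact hu')
  rw [edist_comm x y]
  simpa [edist_eq_enorm_sub, enorm_eq_nnnorm] using h

end Heisenberg

/-! ### Smooth maps between spheres -/

section Radial

variable {m n : ℕ}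

open Classical in
/-- The extension of `f : 𝕊^m → 𝕊^n` to `ℝ^(m+1)` that is constant on open rays from `0`, with value
`0` at `0`. -/
def radialExtension (f : Sph m → Sph n) (x : EuclideanSpace ℝ (Fin (m + 1))) :
    EuclideanSpace ℝ (Fin (n + 1)) :=
  if h : x = 0 then 0 else f ⟨‖x‖⁻¹ • x, by simp [norm_smul, norm_ne_zero_iff.2 h]⟩

theorem norm_radialExtension (f : Sph m → Sph n) {x : EuclideanSpace ℝ (Fin (m + 1))}
    (hx : x ≠ 0) : ‖radialExtension f x‖ = 1 := by
  rw [radialExtension, dif_neg hx]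
  exact norm_eq_of_mem_sphere _

theorem radialExtension_coe (f : Sph m → Sph n) (x : Sph m) :
    radialExtension f x = f x := by
  have hx : ‖(x : EuclideanSpace ℝ (Fin (m + 1)))‖ = 1 := norm_eq_of_mem_sphere x
  have h0 : (x : EuclideanSpace ℝ (Fin (m + 1))) ≠ 0 := by
    rw [← norm_ne_zero_iff, hx]; exact one_ne_zero
  rw [radialExtension, dif_neg h0]
  congr 2
  ext1
  simp [hx]

theorem locallyLipschitzOn_radialExtension {f : Sph m → Sph n}
    (hf : ContMDiff (𝓡 m) (𝓡 n) ∞ f) : LocallyLipschitzOn {0}ᶜ (radialExtension f) := by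
  let U : TopologicalSpace.Opens (EuclideanSpace ℝ (Fin (m + 1))) := ⟨{0}ᶜ, isOpen_compl_singleton⟩
  have hU (x : U) : (x : EuclideanSpace ℝ (Fin (m + 1))) ≠ 0 := x.2
  have hr : ContMDiff 𝓘(ℝ, EuclideanSpace ℝ (Fin (m + 1))) 𝓘(ℝ, EuclideanSpace ℝ (Fin (m + 1))) ∞
      fun x : U => ‖(x : EuclideanSpace ℝ (Fin (m + 1)))‖⁻¹ •
        (x : EuclideanSpace ℝ (Fin (m + 1))) := by
    intro x
    refine contMDiffAt_subtype_iff (f := fun x => ‖x‖⁻¹ • x).2 (ContDiffAt.contMDiffAt ?_)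
    exact ((contDiffAt_norm ℝ (hU x)).inv (norm_ne_zero_iff.2 (hU x))).smul contDiffAt_id
  have hr' := hr.codRestrict_sphere (n := m) fun x => by
    simp [norm_smul, norm_ne_zero_iff.2 (hU x)]
  have h := (contMDiff_coe_sphere (n := n) (E := EuclideanSpace ℝ (Fin (n + 1)))).comp
    (hf.comp hr')
  intro x hx
  have hx' : ContMDiffAt 𝓘(ℝ, EuclideanSpace ℝ (Fin (m + 1)))
      𝓘(ℝ, EuclideanSpace ℝ (Fin (n + 1))) ∞ (fun x : U => radialExtension f x) ⟨x, hx⟩ :=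
    (h ⟨x, hx⟩).congr_of_eventuallyEq (Eventually.of_forall fun y => by
      simp only [radialExtension, dif_neg (hU y)]
      rfl)
  obtain ⟨K, t, ht, hK⟩ := ((contMDiffAt_subtype_iff.1 hx').contDiffAt.of_le
    (m := 1) (by simp)).exists_lipschitzOnWith
  exact ⟨K, t, mem_nhdsWithin_of_mem_nhds ht, hK⟩

end Radial

namespace LipHomotopy

variable {m : ℕ}

/-! ### Maps between the ball, the cube and the sphere -/

/-- A Lipschitz map of `ℝ^(m+1)` to the cube, truncating an affine map in each coordinate. Points of
norm at least `1/2` go to the boundary of the cube: those with `x 0 ≤ 0` to the bottom `t = 0`, the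
others to the remaining faces. -/
def cubeChart (x : EuclideanSpace ℝ (Fin (m + 1))) : CubeSpace m × unitInterval :=
  (fun i => clamp (2 * m * x i.succ + 1 / 2), clamp (4 * x 0))

/-- A Lipschitz function on the cube that is `1` at the centre of the bottom face, less than `1`
elsewhere, and `0` on all faces but the bottom one. -/
def depth (p : CubeSpace m × unitInterval) : unitInterval :=
  clamp (1 - max ‖fun i => 2 * (p.1 i : ℝ) - 1‖ (p.2 : ℝ))

/-- The map of the cube to `ℝ^(m+1)` with components `1 - 2d` and `d (2y - 1)`, where `d` is the depth.
It does not vanish on the bottom face, which it wraps once around the origin, and takes the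
constant value `(1, 0)` on the other faces. -/
def wrap (p : CubeSpace m × unitInterval) : EuclideanSpace ℝ (Fin (m + 1)) :=
  WithLp.toLp 2 (Fin.cons (1 - 2 * (depth p : ℝ)) fun i => (depth p : ℝ) * (2 * (p.1 i : ℝ) - 1))

theorem isLipschitz_coordinate (i : Fin (m + 1)) :
    IsLipschitz fun x : EuclideanSpace ℝ (Fin (m + 1)) => x i :=
  ⟨_, (EuclideanSpace.proj (𝕜 := ℝ) i).lipschitz⟩

theorem isLipschitz_cubeChart : IsLipschitz (cubeChart (m := m)) :=
  IsLipschitz.prodMk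
    (isLipschitz_pi fun i => isLipschitz_clamp.comp
      (((isLipschitz_coordinate i.succ).const_mul _).add (isLipschitz_const _)))
    (isLipschitz_clamp.comp ((isLipschitz_coordinate 0).const_mul 4))

theorem isLipschitz_depth : IsLipschitz (depth (m := m)) := by
  have h1 : IsLipschitz fun p : CubeSpace m × unitInterval => fun i => 2 * (p.1 i : ℝ) - 1 :=
    isLipschitz_pi fun i => (((isLipschitz_coe.comp (isLipschitz_eval i)).comp
      isLipschitz_fst).const_mul 2).add (isLipschitz_const (-1))
  have h2 : IsLipschitz fun p : CubeSpace m × unitInterval =>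
      ‖fun i => 2 * (p.1 i : ℝ) - 1‖ := IsLipschitz.comp ⟨1, lipschitzWith_one_norm⟩ h1
  have h3 : IsLipschitz fun p : CubeSpace m × unitInterval => (p.2 : ℝ) :=
    isLipschitz_coe.comp isLipschitz_snd
  have h4 : IsLipschitz fun p : CubeSpace m × unitInterval =>
      max ‖fun i => 2 * (p.1 i : ℝ) - 1‖ (p.2 : ℝ) := by
    obtain ⟨K, hK⟩ := h2
    obtain ⟨L, hL⟩ := h3
    exact ⟨_, hK.max hL⟩
  refine isLipschitz_clamp.comp ?_
  simpa [neg_add_eq_sub] using (h4.const_mul (-1)).add (isLipschitz_const 1)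

theorem isLipschitz_wrap : IsLipschitz (wrap (m := m)) := by
  have hd : IsLipschitz fun p : CubeSpace m × unitInterval => (depth p : ℝ) :=
    isLipschitz_coe.comp isLipschitz_depth
  have hy (i : Fin m) : IsLipschitz fun p : CubeSpace m × unitInterval => (p.1 i : ℝ) :=
    (isLipschitz_coe.comp (isLipschitz_eval i)).comp isLipschitz_fst
  refine isLipschitz_toLp fun i => ?_
  refine Fin.cases ?_ (fun j => ?_) i
  · simpa [neg_add_eq_sub] using (hd.const_mul (-2)).add (isLipschitz_const 1)
  · simp only [Fin.cons_succ]
    exact (hd.prodMk (hy j)).contDiff_comp (h := fun a : ℝ × ℝ => a.1 * (2 * a.2 - 1))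
      (by fun_prop)

theorem wrap_zero (p : CubeSpace m × unitInterval) : wrap p 0 = 1 - 2 * (depth p : ℝ) := rfl

theorem wrap_succ (p : CubeSpace m × unitInterval) (i : Fin m) :
    wrap p i.succ = (depth p : ℝ) * (2 * (p.1 i : ℝ) - 1) := rfl

theorem depth_eq_zero {p : CubeSpace m × unitInterval}
    (h : p.1 ∈ Cube.boundary (Fin m) ∨ p.2 = 1) : depth p = 0 := by
  refine clamp_of_le (sub_nonpos.2 ?_)
  rcases h with ⟨i, hi⟩ | h
  · refine le_max_of_le_left (le_trans ?_ (norm_le_pi_norm _ i))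
    rcases hi with hi | hi <;> rw [hi] <;> norm_num
  · simp [h]

theorem wrap_eq_single {p : CubeSpace m × unitInterval} (h : depth p = 0) :
    wrap p = EuclideanSpace.single 0 1 := by
  ext i
  refine Fin.cases ?_ (fun j => ?_) i
  · simp [wrap_zero, h]
  · simp [wrap_succ, h]

theorem depth_eq_one {p : CubeSpace m × unitInterval} (hp : p.2 = 0)
    (h : ∀ i, 2 * (p.1 i : ℝ) - 1 = 0) : depth p = 1 := by
  refine clamp_of_ge ?_
  have e : (fun i => 2 * (p.1 i : ℝ) - 1) = 0 := funext h
  rw [e, hp]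
  simp

theorem wrap_ne_zero (y : CubeSpace m) : wrap (y, 0) ≠ 0 := by
  intro h
  have h0 : 1 - 2 * (depth (y, 0) : ℝ) = 0 := congrArg (fun w => w 0) h
  have hs (i : Fin m) : (depth (y, 0) : ℝ) * (2 * (y i : ℝ) - 1) = 0 :=
    congrArg (fun w => w i.succ) h
  have hd : (depth (y, 0) : ℝ) = 1 / 2 := by linarith
  have := depth_eq_one (p := (y, 0)) rfl fun i => by
    have := hs i
    rw [hd] at this
    linarith
  rw [this] at hd
  norm_num at hd

theorem cubeChart_snd_of_nonpos {x : EuclideanSpace ℝ (Fin (m + 1))} (h : x 0 ≤ 0) :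
    (cubeChart x).2 = 0 := clamp_of_le (by linarith)

/-- If `x 0 < 1/4` as well, then `∑ i, (x i.succ)² ≥ 3/16`, so that some `2m |x i.succ|` is at least
`1/2`. -/
theorem cubeChart_of_pos {x : EuclideanSpace ℝ (Fin (m + 1))} (h : 0 < x 0)
    (hx : 1 / 2 ≤ ‖x‖) : (cubeChart x).1 ∈ Cube.boundary (Fin m) ∨ (cubeChart x).2 = 1 := by
  rcases le_or_gt (1 / 4) (x 0) with h4 | h4
  · exact Or.inr (clamp_of_ge (by linarith))
  left
  by_contra hb
  have hb' : ∀ i : Fin m, ¬ (clamp (2 * m * x i.succ + 1 / 2) = 0 ∨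
      clamp (2 * m * x i.succ + 1 / 2) = 1) := fun i hi => hb ⟨i, hi⟩
  have hlt : ∀ i : Fin m, (m * x i.succ) ^ 2 ≤ 1 / 16 := by
    intro i
    have h1 : 0 < 2 * m * x i.succ + 1 / 2 := by
      by_contra! hc
      exact hb' i (Or.inl (clamp_of_le hc))
    have h2 : 2 * m * x i.succ + 1 / 2 < 1 := by
      by_contra! hc
      exact hb' i (Or.inr (clamp_of_ge hc))
    nlinarith
  have hsum : (m : ℝ) ^ 2 * ∑ i : Fin m, x i.succ ^ 2 ≤ m * (1 / 16) := by
    rw [Finset.mul_sum]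
    calc _ ≤ ∑ _i : Fin m, (1 / 16 : ℝ) :=
          Finset.sum_le_sum fun i _ => by rw [← mul_pow]; exact hlt i
      _ = _ := by simp
  have hn := EuclideanSpace.real_norm_sq_eq x
  rw [Fin.sum_univ_succ] at hn
  have h3 : 3 / 16 ≤ ∑ i : Fin m, x i.succ ^ 2 := by nlinarith
  rcases Nat.eq_zero_or_pos m with rfl | hm
  · simp at h3
    norm_num at h3
  · have hm' : (1 : ℝ) ≤ m := by exact_mod_cast hm
    nlinarith

theorem two_mul_clamp_sub_one_mul_nonneg (u : ℝ) :
    0 ≤ (2 * (clamp (2 * m * u + 1 / 2) : ℝ) - 1) * u := by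
  rw [coe_clamp]
  have hm : (0 : ℝ) ≤ m := m.cast_nonneg
  rcases le_total 0 u with h | h
  · refine mul_nonneg (sub_nonneg.2 ?_) h
    have h1 : (1 / 2 : ℝ) ≤ min 1 (2 * m * u + 1 / 2) :=
      le_min (by norm_num) (by nlinarith [mul_nonneg hm h])
    linarith [le_max_right 0 (min 1 (2 * m * u + 1 / 2))]
  · refine mul_nonneg_of_nonpos_of_nonpos (sub_nonpos.2 ?_) h
    have h1 : max 0 (min 1 (2 * m * u + 1 / 2)) ≤ 1 / 2 :=
      max_le (by norm_num) (min_le_of_right_le (by nlinarith [mul_nonneg hm (neg_nonneg.2 h)]))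
    linarith

/-- The linear homotopy between `wrap ∘ cubeChart` on the sphere of radius `1/2` and the identity on the
unit sphere. -/
def collar (x : EuclideanSpace ℝ (Fin (m + 1))) : EuclideanSpace ℝ (Fin (m + 1)) :=
  (2 - 2 * ‖x‖) • wrap (cubeChart x) + (2 * ‖x‖ - 1) • x

/-- On the collar `1/2 ≤ ‖x‖ ≤ 1`, the vector `wrap (cubeChart x)` is never a negative multiple of `x`. -/
theorem collar_ne_zero {x : EuclideanSpace ℝ (Fin (m + 1))} (h1 : 1 / 2 ≤ ‖x‖) (h2 : ‖x‖ ≤ 1) :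
    collar x ≠ 0 := by
  intro h
  set τ := 2 - 2 * ‖x‖ with hτ
  have hl : 2 * ‖x‖ - 1 = 1 - τ := by rw [hτ]; ring
  have hτ0 : 0 ≤ τ := by linarith
  have hτ1 : τ ≤ 1 := by linarith
  have hx0 : x ≠ 0 := norm_pos_iff.1 (by linarith)
  rw [collar, ← hτ, hl] at h
  set p := cubeChart x with hp
  have e0 : τ * (1 - 2 * (depth p : ℝ)) + (1 - τ) * x 0 = 0 := congrArg (fun w => w 0) h
  have es (i : Fin m) : τ * ((depth p : ℝ) * (2 * (p.1 i : ℝ) - 1)) + (1 - τ) * x i.succ = 0 :=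
    congrArg (fun w => w i.succ) h
  have hd0 : (0 : ℝ) ≤ depth p := (depth p).2.1
  rcases lt_or_ge 0 (x 0) with hs | hs
  · rw [depth_eq_zero (cubeChart_of_pos hs h1)] at e0
    simp only [Set.Icc.coe_zero, mul_zero, sub_zero, mul_one] at e0
    nlinarith [mul_nonneg (sub_nonneg.2 hτ1) hs.le]
  have hp2 : p.2 = 0 := cubeChart_snd_of_nonpos hs
  have hv (i : Fin m) : 0 ≤ (2 * (p.1 i : ℝ) - 1) * x i.succ :=
    two_mul_clamp_sub_one_mul_nonneg _
  -- pairing the equation with `x i` makes both summands nonnegative, so that they vanish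
  have hu (i : Fin m) : (1 - τ) * x i.succ = 0 := by
    have h3 : τ * depth p * ((2 * (p.1 i : ℝ) - 1) * x i.succ) + (1 - τ) * x i.succ ^ 2 = 0 := by
      linear_combination x i.succ * es i
    have h4 : 0 ≤ (1 - τ) * x i.succ ^ 2 := mul_nonneg (sub_nonneg.2 hτ1) (sq_nonneg _)
    have h5 := mul_nonneg (mul_nonneg hτ0 hd0) (hv i)
    have h6 : (1 - τ) * x i.succ ^ 2 = 0 := by linarith
    rcases mul_eq_zero.1 h6 with h | h
    · rw [h, zero_mul]
    · rw [pow_eq_zero_iff two_ne_zero] at h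
      rw [h, mul_zero]
  rcases hτ1.lt_or_eq with hlt | heq
  · have hu' (i : Fin m) : x i.succ = 0 :=
      (mul_eq_zero.1 (hu i)).resolve_left (by linarith)
    have hv' (i : Fin m) : 2 * (p.1 i : ℝ) - 1 = 0 := by
      have : (p.1 i : ℝ) = 1 / 2 := by
        simp only [hp, cubeChart, hu', coe_clamp]
        norm_num
      rw [this]; norm_num
    rw [depth_eq_one hp2 hv'] at e0
    simp only [Set.Icc.coe_one] at e0
    have h7 : x 0 = 0 := by nlinarith
    refine hx0 ?_
    ext i
    exact Fin.cases h7 hu' i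
  · rw [heq, sub_self, zero_smul, add_zero, one_smul] at h
    refine wrap_ne_zero p.1 ?_
    rw [← hp2]
    exact h

theorem collar_of_norm_eq_one {x : EuclideanSpace ℝ (Fin (m + 1))} (h : ‖x‖ = 1) :
    collar x = x := by
  rw [collar, h]; norm_num

theorem collar_of_norm_eq_half {x : EuclideanSpace ℝ (Fin (m + 1))} (h : ‖x‖ = 1 / 2) :
    collar x = wrap (cubeChart x) := by
  rw [collar, h]; norm_num

theorem isLipschitz_collar : IsLipschitz fun x : Metric.closedBall
    (0 : EuclideanSpace ℝ (Fin (m + 1))) 1 => collar (x : EuclideanSpace ℝ (Fin (m + 1))) := by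
  have hx : IsLipschitz fun x : Metric.closedBall (0 : EuclideanSpace ℝ (Fin (m + 1))) 1 =>
      (x : EuclideanSpace ℝ (Fin (m + 1))) := ⟨1, LipschitzWith.subtype_val _⟩
  have hn := IsLipschitz.comp ⟨1, lipschitzWith_one_norm⟩ hx
  have hw := isLipschitz_wrap.comp (isLipschitz_cubeChart.comp hx)
  exact (hn.prodMk (hw.prodMk hx)).contDiff_comp
    (h := fun a : ℝ × EuclideanSpace ℝ (Fin (m + 1)) × EuclideanSpace ℝ (Fin (m + 1)) =>
      (2 - 2 * a.1) • a.2.1 + (2 * a.1 - 1) • a.2.2) (by fun_prop)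

end LipHomotopy

/-! ### From a null homotopy to an extension of small rank -/

open LipHomotopy in
/-- Lipschitz maps on the inner half and on the outer half of the unit ball that agree on the sphere of
radius `1/2` glue to a Lipschitz map of the ball. -/
theorem exists_lipschitzOnWith_of_glue {V W : Type*} [NormedAddCommGroup V] [NormedSpace ℝ V]
    [Nontrivial V] [PseudoMetricSpace W] {g k F : V → W}
    (hg : IsLipschitz fun x : Metric.closedBall (0 : V) 1 => g x)
    (hk : IsLipschitz fun x : Metric.closedBall (0 : V) 1 => k x)
    (hgk : ∀ x, ‖x‖ = 1 / 2 → g x = k x) (hFg : ∀ x, ‖x‖ ≤ 1 / 2 → F x = g x)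
    (hFk : ∀ x, 1 / 2 < ‖x‖ → ‖x‖ ≤ 1 → F x = k x) :
    ∃ K, LipschitzOnWith K F (Metric.closedBall 0 1) := by
  obtain ⟨e, he⟩ := exists_norm_eq V (zero_le_one' ℝ)
  -- the radial retraction onto the sphere of radius `1 / 2`, with an arbitrary value at `0`
  obtain ⟨ρ, hρ, hρd⟩ : ∃ ρ : V → V, (∀ x, ‖ρ x‖ = 1 / 2) ∧ ∀ x, ‖x - ρ x‖ = |‖x‖ - 1 / 2| := by
    have : ∀ x : V, ∃ y : V, ‖y‖ = 1 / 2 ∧ ‖x - y‖ = |‖x‖ - 1 / 2| := by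
      intro x
      by_cases hx : x = 0
      · exact ⟨(1 / 2 : ℝ) • e, by simp [norm_smul, he], by simp [hx, norm_smul, he]⟩
      · have hn : ‖x‖ ≠ 0 := norm_ne_zero_iff.2 hx
        refine ⟨(1 / 2 * ‖x‖⁻¹) • x, by simp [norm_smul, hn], ?_⟩
        calc ‖x - (1 / 2 * ‖x‖⁻¹) • x‖ = ‖((‖x‖ - 1 / 2) * ‖x‖⁻¹) • x‖ := by
              rw [sub_mul, mul_inv_cancel₀ hn, sub_smul, one_smul]
          _ = _ := by
              rw [norm_smul, norm_mul, norm_inv, norm_norm, mul_assoc, inv_mul_cancel₀ hn,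
                mul_one, Real.norm_eq_abs]
    choose ρ h1 h2 using this
    exact ⟨ρ, h1, h2⟩
  obtain ⟨K, hK⟩ := IsLipschitz.glue hg hk (fun x => ‖(x : V)‖)
    (by
      have := lipschitzWith_one_norm.comp (LipschitzWith.subtype_val (Metric.closedBall (0 : V) 1))
      rwa [one_mul] at this)
    (fun x => ⟨ρ x, by rw [mem_closedBall_zero_iff, hρ]; norm_num⟩)
    (fun x => by
      rw [Subtype.edist_eq, edist_eq_enorm_sub, edist_eq_enorm_sub, ← ofReal_norm, hρd,
        Real.enorm_eq_ofReal_abs])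
    (fun x => hgk _ (hρ _))
  refine ⟨K, lipschitzOnWith_iff_restrict.2 ?_⟩
  convert hK using 1
  funext x
  rw [domRestrict_apply]
  split_ifs with h
  · exact hFg _ h
  · exact hFk _ (not_le.1 h) (mem_closedBall_zero_iff.1 x.2)

/-- The derivative of a map into the unit sphere takes values orthogonal to the value of the map. -/
theorem finrank_range_fderiv_lt_of_norm_eq_one {V W : Type*} [NormedAddCommGroup V]
    [NormedSpace ℝ V] [NormedAddCommGroup W] [InnerProductSpace ℝ W] [FiniteDimensional ℝ W]
    {F : V → W} {x : V} (hF : DifferentiableAt ℝ F x) (h1 : ∀ᶠ y in 𝓝 x, ‖F y‖ = 1) :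
    Module.finrank ℝ (LinearMap.range (fderiv ℝ F x).toLinearMap) < Module.finrank ℝ W := by
  refine Submodule.finrank_lt fun htop => ?_
  have hd := (hF.hasFDerivAt.norm_sq).unique
    ((hasFDerivAt_const (1 : ℝ) x).congr_of_eventuallyEq (by
      filter_upwards [h1] with y hy
      rw [hy, one_pow]))
  obtain ⟨v, hv⟩ : F x ∈ LinearMap.range (fderiv ℝ F x).toLinearMap := htop ▸ Submodule.mem_top
  have hv' : fderiv ℝ F x v = F x := hv
  have := congrArg (fun L => L v) hd
  simp [hv', h1.self_of_nhds] at this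

open LipHomotopy Heisenberg

variable {m n : ℕ}

theorem isLipschitz_radialExtension_wrap {f : Sph m → Sph n} (hf : ContMDiff (𝓡 m) (𝓡 n) ∞ f) :
    IsLipschitz fun y : CubeSpace m => radialExtension f (wrap (y, 0)) :=
  (isLipschitz_wrap.comp (isLipschitz_id.prodMk (isLipschitz_const 0))).locallyLipschitzOn_comp
    (locallyLipschitzOn_radialExtension hf) wrap_ne_zero

/-- The Lipschitz loop in `ℍ_n` based at `p` that is the composition of the bottom face of `wrap`, the map
`f` and the Legendrian sphere, translated by `a`. -/
def sphereLoop {f : Sph m → Sph n} (hf : ContMDiff (𝓡 m) (𝓡 n) ∞ f) (a : HeisCoord n)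
    {p : Heisenberg n}
    (ha : leftMul a (whitney (radialExtension f (EuclideanSpace.single 0 1))) = p.coord) :
    LipLoop m p where
  toFun y := ⟨leftMul a (whitney (radialExtension f (wrap (y, 0))))⟩
  lipschitz := by
    have h := isLipschitz_leftMul_whitney (V := Fin m → ℝ)
      (β := fun y => radialExtension f (wrap (fun i => clamp (y i), 0)))
      (((isLipschitz_radialExtension_wrap hf)).comp
        (isLipschitz_pi fun i => isLipschitz_clamp.comp ⟨1, LipschitzWith.eval i⟩))
      (fun y => norm_radialExtension f (wrap_ne_zero _)) a
    have h' := h.comp (g := fun (y : CubeSpace m) i => (y i : ℝ))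
      (isLipschitz_pi fun i => isLipschitz_coe.comp (isLipschitz_eval i))
    simpa only [clamp_coe] using h'
  boundary y hy := by
    ext1
    simp only [wrap_eq_single (depth_eq_zero (p := (y, 0)) (Or.inl hy)), ha]

/-- A null homotopy of `sphereLoop` gives a Lipschitz extension of `f` to the ball whose rank is at most
`n` almost everywhere: on the inner half of the ball it factors through the homotopy, so through
a Lipschitz map to `ℍ_n`, and on the collar it takes values in the sphere. -/
theorem exists_extension_of_homotopic [NeZero m] {f : Sph m → Sph n}
    (hf : ContMDiff (𝓡 m) (𝓡 n) ∞ f) (a : HeisCoord n) {p : Heisenberg n}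
    (ha : leftMul a (whitney (radialExtension f (EuclideanSpace.single 0 1))) = p.coord)
    (hc : LipHomotopic (sphereLoop hf a ha) (constLoop m p)) :
    ∃ F : EuclideanSpace ℝ (Fin (m + 1)) → EuclideanSpace ℝ (Fin (n + 1)),
      (∃ K, LipschitzOnWith K F (Metric.closedBall 0 1)) ∧ (∀ x : Sph m, F x = f x) ∧
      ∀ᵐ x, x ∈ Metric.ball (0 : EuclideanSpace ℝ (Fin (m + 1))) 1 → DifferentiableAt ℝ F x →
        Module.finrank ℝ (LinearMap.range (fderiv ℝ F x).toLinearMap) < n + 1 := by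
  obtain ⟨H, hH, h0, h1, hb⟩ := hc
  let P : HeisCoord n → EuclideanSpace ℝ (Fin (n + 1)) := fun v => whitneyInv (leftMul (-a) v)
  have hP : ContDiff ℝ 1 P := contDiff_whitneyInv.comp (contDiff_leftMul (-a))
  have hPw {w : EuclideanSpace ℝ (Fin (m + 1))} (hw : w ≠ 0) :
      P (leftMul a (whitney (radialExtension f w))) = radialExtension f w := by
    simp only [P, leftMul_neg_leftMul, whitneyInv_whitney (norm_radialExtension f hw)]
  let G : EuclideanSpace ℝ (Fin (m + 1)) → Heisenberg n := fun x => H (cubeChart x)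
  have hG : IsLipschitz G := hH.comp isLipschitz_cubeChart
  -- away from the ball of radius `1 / 2`, the chart takes values in the boundary of the cube,
  -- where the homotopy is given by the loop and the base point
  have hPG (x) (hx : 1 / 2 ≤ ‖x‖) : P (G x).coord = radialExtension f (wrap (cubeChart x)) := by
    rcases le_or_gt (x 0) 0 with hs | hs
    · have e : cubeChart x = ((cubeChart x).1, 0) :=
        Prod.ext rfl (cubeChart_snd_of_nonpos hs)
      simp only [G]
      rw [e, h0]
      exact hPw (wrap_ne_zero _)
    · have hd := cubeChart_of_pos hs hx
      have e : G x = p := by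
        rcases hd with hd | hd
        · exact hb _ hd _
        · have e : cubeChart x = ((cubeChart x).1, 1) := Prod.ext rfl hd
          simp only [G]
          rw [e, h1]
          rfl
      rw [e, wrap_eq_single (depth_eq_zero hd), ← ha]
      exact hPw (by simp)
  let F : EuclideanSpace ℝ (Fin (m + 1)) → EuclideanSpace ℝ (Fin (n + 1)) := fun x =>
    if ‖x‖ ≤ 1 / 2 then P (G x).coord else radialExtension f (collar x)
  have hball : IsLipschitz fun x : Metric.closedBall (0 : EuclideanSpace ℝ (Fin (m + 1))) 1 =>
      (x : EuclideanSpace ℝ (Fin (m + 1))) := ⟨1, LipschitzWith.subtype_val _⟩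
  refine ⟨F, ?_, fun x => ?_, ?_⟩
  · let A : Set (Metric.closedBall (0 : EuclideanSpace ℝ (Fin (m + 1))) 1) :=
      {x | 1 / 2 ≤ ‖(x : EuclideanSpace ℝ (Fin (m + 1)))‖}
    have hA : IsCompact A :=
      (isClosed_le continuous_const continuous_subtype_val.norm).isCompact
    have hcol : Continuous fun x : Metric.closedBall (0 : EuclideanSpace ℝ (Fin (m + 1))) 1 =>
      collar (x : EuclideanSpace ℝ (Fin (m + 1))) := isLipschitz_collar.choose_spec.continuous
    obtain ⟨K, hK⟩ := ((locallyLipschitzOn_radialExtension hf).mono (by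
      rintro _ ⟨x, hx, rfl⟩
      exact collar_ne_zero hx (mem_closedBall_zero_iff.1 x.2))).exists_lipschitzOnWith_of_compact
      (hA.image hcol)
    -- a globally Lipschitz substitute for the radial extension, which is not Lipschitz near `0`
    obtain ⟨k, hk, hkf⟩ := hK.extend_finite_dimension
    have hkf' (x : EuclideanSpace ℝ (Fin (m + 1))) (hx : 1 / 2 ≤ ‖x‖) (hx' : ‖x‖ ≤ 1) :
        radialExtension f (collar x) = k (collar x) :=
      hkf ⟨⟨x, mem_closedBall_zero_iff.2 hx'⟩, hx, rfl⟩
    refine exists_lipschitzOnWith_of_glue (g := fun x => P (G x).coord)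
      (k := fun x => k (collar x))
      ((isLipschitz_coord_comp (hG.comp hball)).contDiff_comp hP)
      (IsLipschitz.comp ⟨_, hk⟩ isLipschitz_collar) (fun x hx => ?_) (fun x hx => if_pos hx)
      (fun x hx hx' => ?_)
    · rw [← hkf' x hx.ge (by rw [hx]; norm_num), hPG x hx.ge, collar_of_norm_eq_half hx]
    · rw [← hkf' x hx.le hx']
      exact if_neg (not_le.2 hx)
  · have hx : ‖(x : EuclideanSpace ℝ (Fin (m + 1)))‖ = 1 := norm_eq_of_mem_sphere x
    simp only [F]
    rw [if_neg (by rw [hx]; norm_num), collar_of_norm_eq_one hx, radialExtension_coe]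
  · obtain ⟨L, hL⟩ := hG
    have hz : LipschitzWith (1 * L) fun x => (G x).coord.1 := lipschitzWith_coord_fst.comp hL
    have hs : ∀ᵐ x : EuclideanSpace ℝ (Fin (m + 1)), ‖x‖ ≠ 1 / 2 := by
      have := Measure.addHaar_sphere_of_ne_zero (volume : Measure (EuclideanSpace ℝ (Fin (m + 1))))
        0 (r := 1 / 2) (by norm_num)
      rw [ae_iff]
      convert this using 2
      ext x
      simp
    filter_upwards [hz.ae_differentiableAt (μ := volume), hs] with x hxz hxs hx hd
    rcases lt_or_gt_of_ne hxs with hlt | hgt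
    · have e : F =ᶠ[𝓝 x] fun y => P ((G y).coord.1, (G y).coord.2) := by
        filter_upwards [(continuous_norm.tendsto x).eventually (eventually_lt_nhds hlt)] with y hy
        exact if_pos (le_of_lt hy)
      rw [e.fderiv_eq]
      refine Nat.lt_succ_of_le (finrank_range_fderiv_comp_le (C := 2 * L ^ 2) hxz
        (fun p q => ?_) (hP.differentiable one_ne_zero).differentiableAt)
      rw [← dist_eq_norm, dist_comm]
      exact abs_vertical_le_of_lipschitzWith hL p q
    · have h := finrank_range_fderiv_lt_of_norm_eq_one hd ?_
      · rwa [finrank_euclideanSpace_fin] at h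
      filter_upwards [(continuous_norm.tendsto x).eventually (eventually_gt_nhds hgt),
        Metric.isOpen_ball.mem_nhds hx] with y hy hy'
      have e : F y = radialExtension f (collar y) := if_neg (not_le.2 hy)
      rw [e]
      exact norm_radialExtension f (collar_ne_zero (le_of_lt hy)
        (le_of_lt (mem_ball_zero_iff.1 hy')))

end

/-- If `π_m(𝕊^n)` is rank-essential, then `π_m^Lip(ℍ_n)` is nontrivial, for every base point. -/
theorem theorem1p3 (m n : ℕ) [NeZero m] [NeZero n] (h : RankEssential m n) (p : Heisenberg n) :
    ∃ a : LipschitzHomotopyGroup m (Heisenberg n) p, a ≠ 1 := by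
  obtain ⟨f, hf, hess⟩ := h
  obtain ⟨a, ha⟩ := Heisenberg.exists_leftMul_eq p.coord
    (Heisenberg.whitney (radialExtension f (EuclideanSpace.single 0 1)))
  refine ⟨Quotient.mk _ (sphereLoop hf a ha), fun h1 => ?_⟩
  obtain ⟨F, hF, hFf, hrank⟩ := exists_extension_of_homotopic hf a ha (Quotient.exact h1)
  refine (hess F hF hFf).ne' (MeasureTheory.measure_mono_null ?_ (MeasureTheory.ae_iff.1 hrank))
  rintro x ⟨hx, hd, hr⟩ hlt
  exact (hlt hx hd).ne hr
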